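/- **Setting.** There are $N$ players and $K$ arms, $N\le K$, and rounds $t=1,\dots,T$. In round $t$ an arbitrary (fixed in advance) set $P_t$ of players and an arbitrary set $A_t$ of arms is available; each available arm $j\in A_t$ has a strict preference ranking over $P_t$ and a capacity $c_j(t)\ge 1$, all known to the platform. The mean rewards $\mu_{i,j}\in(0,1)$ are unknown to the platform, and $\mu_{i,j}\ne\mu_{i,j'}$ whenever $i\in P_t$ and $j\neq j'$ are both in $A_t$ for some $t$. In round $t$ the platform chooses a matching $m_t$ of available players to available arms ($m_t(i)=0$ means unmatched, and $\mu_{i,0}:=0$); a player matched to arm $j$ produces an independent Bernoulli reward of mean $\mu_{i,j}$, which is observed, and an unmatched player gets reward $0$. Let $T_i=|\{t\le T: i\in P_t\}|$, and for $i\in P_t$ let $t_i=|\{s\le t: i\in P_s\}|$. Let $$\Delta=\min\{|\mu_{i,j}-\mu_{i,j'}| : t\le T,\ i\in P_t,\ j,j'\in A_t,\ j\ne j'\}$$ (some round is assumed to have an available player and two available arms, so that $\Delta$ is defined; then $\Delta>0$). A matching within the capacities is stable in round $t$ if there is no pair $(i,j)\in P_t\times A_t$ with $\mu_{i,j}>\mu_{i,m(i)}$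 such that $j$ has a vacancy or prefers $i$ to one of the players matched to it. In each round there is a unique player-optimal stable matching $\overline m_t$, which every available player weakly prefers to every stable matching. The player-optimal stable regret of player $i$ is $$\overline R_i(T_i)=\sum_{t\le T,\ i\in P_t}\bigl(\mu_{i,\overline m_t(i)}-\mathbb E[r_i(t)]\bigr),$$ where $r_i(t)$ is the reward of player $i$ in round $t$. **Algorithm (AC-ETGS).** Let $T_{i,j}$ and $\hat\mu_{i,j}$ be the number of earlier matches between player $i$ and arm $j$ and the empirical mean of their rewards, and put $\mathrm{UCB}_{i,j}=\hat\mu_{i,j}+\sqrt{\log t_i/T_{i,j}}$ and $\mathrm{LCB}_{i,j}=\hat\mu_{i,j}-\sqrt{\log t_i/T_{i,j}}$ (respectively $+\infty$ and $-\infty$ if $T_{i,j}=0$). In round $t$, if for every $i\in P_t$ there is an ordering $\sigma_i$ of $A_t$ with $\mathrm{LCB}_{i,\sigma_i(k)}>\mathrm{UCB}_{i,\sigma_i(k+1)}$ for all $1\le k<|A_t|$, the platform uses the output of the player-proposing Gale–Shapley algorithm, run with the players' rankings of $A_t$ by decreasing UCB and with the true rankings and capacities of the arms. Otherwise it uses a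 uniformly random one-to-one matching of $\min(|P_t|,|A_t|)$ pairs between $P_t$ and $A_t$. **Theorem.** Assume that all $T_i$ are comparable: $T_i\le\kappa T_{i'}$ for all players $i,i'$, for some constant $\kappa$. Then under AC-ETGS $$\overline R_i(T_i)=O\bigl(NK^2\log T_i/\Delta^2\bigr)$$ for every player $i$. That is, for every $\kappa$ there is a constant $C$, depending only on $\kappa$, such that for all $N\le K$, all instances and all horizons $T$ as above with $T_i\le\kappa T_{i'}$ for all $i,i'$, and every player $i$ with $T_i\ge2$, one has $|\overline R_i(T_i)|\le C\,NK^2\log T_i/\Delta^2$. -/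

import Mathlib

open scoped ENNReal

noncomputable section

namespace SleepingBandits

/-- An assignment of arms to players; `none` means that the player is unmatched. -/
abbrev Matching (N K : ℕ) : Type := Fin N → Option (Fin K)

/-- What the platform observes in one round: for each player either `none` (absent or unmatched)
or the matched arm together with the observed Bernoulli reward (`true` is reward 1). -/
abbrev Obs (N K : ℕ) : Type := Fin N → Option (Fin K × Bool)

/-- The part of the problem which the platform is told: in every round `t = 0, 1, 2, …` the
available players and arms, the strict preference ranking of each available arm over the available
players (a smaller rank is better), and the capacities of the arms. -/
structure Environment (N K : ℕ) where
  players : ℕ → Finset (Fin N)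
  arms : ℕ → Finset (Fin K)
  rank : ℕ → Fin K → Fin N → ℕ
  rank_injOn : ∀ t, ∀ j ∈ arms t, Set.InjOn (rank t j) (players t)
  capacity : ℕ → Fin K → ℕ
  capacity_pos : ∀ t, ∀ j ∈ arms t, 1 ≤ capacity t j

/-- A problem instance: an environment together with the unknown mean rewards. The means lie in
`(0,1)`, and those of simultaneously available arms are distinct for every available player. -/
structure Market (N K : ℕ) extends Environment N K where
  mean : Fin N → Fin K → ℝ
  mean_pos : ∀ i j, 0 < mean i j
  mean_lt_one : ∀ i j, mean i j < 1
  mean_ne : ∀ t, ∀ i ∈ players t, ∀ j ∈ arms t, ∀ j' ∈ arms t, j ≠ j' → mean i j ≠ mean i j'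

/-! ### The Gale--Shapley algorithm (players propose) -/

/-- State of the algorithm: the free players, for each player the arms to which the player has not
yet proposed (best first), and the current tentative assignment. -/
structure GSState (N K : ℕ) where
  free : Finset (Fin N)
  todo : Fin N → List (Fin K)
  assigned : Matching N K

/-- The players currently matched to arm `a`. -/
def matchedTo {N K : ℕ} (m : Matching N K) (a : Fin K) : Finset (Fin N) :=
  Finset.univ.filter fun i => m i = some a

open Classical in
/-- One pass of the main loop. A free player who has proposed to every arm is removed from the
free players. Otherwise the player proposes to the best arm to which it has not yet proposed; an
arm with a vacancy accepts, and a full arm accepts if it prefers the proposer to the worst of its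
players, who then becomes free. -/
def gsStep {N K : ℕ} (rank : Fin K → Fin N → ℕ) (capacity : Fin K → ℕ) (s : GSState N K) :
    GSState N K :=
  if hfree : s.free.Nonempty then
    let p := s.free.min' hfree
    match s.todo p with
    | [] => { s with free := s.free.erase p }
    | a :: l =>
      let todo' := Function.update s.todo p l
      if (matchedTo s.assigned a).card < capacity a then
        { free := s.free.erase p
          todo := todo'
          assigned := Function.update s.assigned p (some a) }
      else if hw : ∃ q ∈ matchedTo s.assigned a,
          (∀ q' ∈ matchedTo s.assigned a, rank a q' ≤ rank a q) ∧ rank a p < rank a q then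
        { free := insert hw.choose (s.free.erase p)
          todo := todo'
          assigned := Function.update (Function.update s.assigned hw.choose none) p (some a) }
      else
        { s with todo := todo' }
  else s

/-- The output of the Gale--Shapley algorithm. Every pass makes a new proposal or removes a player
that has made all its proposals, so the loop ends within `N * (K + 1)` passes; a pass with no free
player changes nothing. -/
def galeShapley {N K : ℕ} (players : Finset (Fin N)) (prefList : Fin N → List (Fin K))
    (rank : Fin K → Fin N → ℕ) (capacity : Fin K → ℕ) : Matching N K :=
  ((gsStep rank capacity)^[N * (K + 1)]
    { free := players, todo := prefList, assigned := fun _ => none }).assigned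

/-! ### Exploration: uniform random matchings -/

open Classical in
/-- The one-to-one matchings between `P` and `A` which consist of `min |P| |A|` pairs. -/
def maxMatchings {N K : ℕ} (P : Finset (Fin N)) (A : Finset (Fin K)) : Finset (Matching N K) :=
  Finset.univ.filter fun m =>
    (∀ i j, m i = some j → i ∈ P ∧ j ∈ A) ∧
    (∀ i i' j, m i = some j → m i' = some j → i = i') ∧
    (Finset.univ.filter fun i => (m i).isSome).card = min P.card A.card

theorem maxMatchings_nonempty {N K : ℕ} (P : Finset (Fin N)) (A : Finset (Fin K)) :
    (maxMatchings P A).Nonempty := by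
  classical
  obtain ⟨s, hsP, hs⟩ := Finset.exists_subset_card_eq (min_le_left P.card A.card)
  obtain ⟨u, huA, hu⟩ := Finset.exists_subset_card_eq (min_le_right P.card A.card)
  let e := Finset.equivOfCardEq (hs.trans hu.symm)
  refine ⟨fun i => if h : i ∈ s then some (e ⟨i, h⟩ : Fin K) else none, ?_⟩
  simp only [maxMatchings, Finset.mem_filter, Finset.mem_univ, true_and]
  refine ⟨?_, ?_, ?_⟩
  · intro i j h
    by_cases hi : i ∈ s
    · simp only [hi, dite_true, Option.some.injEq] at h
      exact ⟨hsP hi, h ▸ huA (e ⟨i, hi⟩).2⟩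
    · simp [hi] at h
  · intro i i' j h h'
    by_cases hi : i ∈ s
    · by_cases hi' : i' ∈ s
      · simp only [hi, hi', dite_true, Option.some.injEq] at h h'
        have := e.injective (Subtype.ext (h.trans h'.symm))
        exact congrArg Subtype.val this
      · simp [hi'] at h'
    · simp [hi] at h
  · rw [← hs]
    congr 1
    ext i
    by_cases hi : i ∈ s <;> simp [hi]

/-! ### Statistics and confidence bounds -/

namespace Environment

variable {N K : ℕ} (E : Environment N K)

/-- `T_i` for the horizon `T`: the number of rounds `t < T` in which player `i` is available. -/
def numRounds (T : ℕ) (i : Fin N) : ℕ :=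
  ((Finset.range T).filter fun t => i ∈ E.players t).card

/-- The local round index of player `i` in round `t` (counted from 1): the number of rounds up to
and including `t` in which player `i` is available. -/
def localIndex (t : ℕ) (i : Fin N) : ℕ := E.numRounds (t + 1) i

end Environment

open Classical in
/-- The number of matches between player `i` and arm `j` in the past `h`. -/
def matchCount {N K t : ℕ} (h : Fin t → Obs N K) (i : Fin N) (j : Fin K) : ℕ :=
  (Finset.univ.filter fun s => ∃ b, h s i = some (j, b)).card

open Classical in
/-- The empirical mean reward of arm `j` observed by player `i` in the past `h`. -/
def empMean {N K t : ℕ} (h : Fin t → Obs N K) (i : Fin N) (j : Fin K) : ℝ :=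
  ((Finset.univ.filter fun s => h s i = some (j, true)).card : ℝ) / matchCount h i j

namespace Environment

variable {N K : ℕ} (E : Environment N K)

/-- The upper confidence bound; `+∞` if there is no sample. -/
def ucb {t : ℕ} (h : Fin t → Obs N K) (i : Fin N) (j : Fin K) : EReal :=
  if matchCount h i j = 0 then ⊤
  else ((empMean h i j + √(Real.log (E.localIndex t i) / matchCount h i j) : ℝ) : EReal)

/-- The lower confidence bound; `-∞` if there is no sample. -/
def lcb {t : ℕ} (h : Fin t → Obs N K) (i : Fin N) (j : Fin K) : EReal :=
  if matchCount h i j = 0 then ⊥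
  else ((empMean h i j - √(Real.log (E.localIndex t i) / matchCount h i j) : ℝ) : EReal)

/-- The exploitation condition: every available player has an ordering `σ` of the available arms
along which each lower confidence bound exceeds the next upper confidence bound. -/
def Separated {t : ℕ} (h : Fin t → Obs N K) : Prop :=
  ∀ i ∈ E.players t, ∃ σ : Fin (E.arms t).card ≃ E.arms t,
    ∀ (k : ℕ) (hk : k + 1 < (E.arms t).card),
      E.ucb h i (σ ⟨k + 1, hk⟩) < E.lcb h i (σ ⟨k, Nat.lt_of_succ_lt hk⟩)

open Classical in
/-- The available arms sorted by the upper confidence bounds of player `i`, largest first. -/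
def ucbList {t : ℕ} (h : Fin t → Obs N K) (i : Fin N) : List (Fin K) :=
  ((E.arms t).sort (· ≤ ·)).insertionSort fun j j' => E.ucb h i j' ≤ E.ucb h i j

end Environment

/-- A policy chooses in round `t`, given the observations in the rounds before `t`, a probability
distribution on matchings. -/
abbrev Policy (N K : ℕ) : Type := (t : ℕ) → (Fin t → Obs N K) → PMF (Matching N K)

open Classical in
/-- The Awake Centralized Explore-Then-Gale--Shapley algorithm. -/
def acETGS {N K : ℕ} (E : Environment N K) : Policy N K := fun t h =>
  if E.Separated h then
    PMF.pure (galeShapley (E.players t) (E.ucbList h) (E.rank t) (E.capacity t))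
  else
    PMF.uniformOfFinset (maxMatchings (E.players t) (E.arms t)) (maxMatchings_nonempty _ _)

/-! ### Rewards, law of the process, stability and regret -/

/-- The product of finitely many probability mass functions (independent coordinates). -/
def piPMF {N : ℕ} {α : Type} [Fintype α] (p : Fin N → PMF α) : PMF (Fin N → α) :=
  PMF.ofFintype (fun o => ∏ i, p i (o i)) (by
    have h := (Finset.prod_univ_sum (fun _ : Fin N => (Finset.univ : Finset α))
      (fun i a => p i a)).symm
    rw [Fintype.piFinset_univ] at h
    rw [h]
    refine Finset.prod_eq_one fun i _ => ?_
    exact (tsum_fintype (fun a => p i a)).symm.trans (p i).tsum_coe)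

/-- The Bernoulli distribution with mean `p`. -/
def bernoulliPMF (p : ℝ) (h0 : 0 ≤ p) (h1 : p ≤ 1) : PMF Bool :=
  PMF.ofFintype (fun b => if b then ENNReal.ofReal p else ENNReal.ofReal (1 - p)) (by
    rw [Fintype.sum_bool, if_pos rfl, if_neg Bool.false_ne_true,
      ← ENNReal.ofReal_add h0 (sub_nonneg.2 h1), add_sub_cancel, ENNReal.ofReal_one])

/-- The reward that one player receives. -/
def reward {K : ℕ} : Option (Fin K × Bool) → ℝ
  | some (_, true) => 1
  | _ => 0

namespace Market

variable {N K : ℕ} (M : Market N K)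

/-- The mean reward of player `i` for an assignment; it is 0 if the player is unmatched. -/
def value (i : Fin N) : Option (Fin K) → ℝ
  | none => 0
  | some j => M.mean i j

/-- What is observed from player `i` if it is assigned `a`: nothing if it is unmatched, and
otherwise the arm and a Bernoulli reward with mean `M.mean i j`. -/
def playerLaw (i : Fin N) : Option (Fin K) → PMF (Option (Fin K × Bool))
  | none => PMF.pure none
  | some j => (bernoulliPMF (M.mean i j) (M.mean_pos i j).le (M.mean_lt_one i j).le).map
      fun b => some (j, b)

/-- The law of the observations of a round in which the matching `m` is used. -/
def roundLaw (m : Matching N K) : PMF (Obs N K) := piPMF fun i => M.playerLaw i (m i)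

/-- The law of the observations in the first `t` rounds under the policy `π`. -/
def law (π : Policy N K) : (t : ℕ) → PMF (Fin t → Obs N K)
  | 0 => PMF.pure Fin.elim0
  | t + 1 => (law π t).bind fun h => (π t h).bind fun m =>
      (M.roundLaw m).map fun o => Fin.snoc (α := fun _ => Obs N K) h o

/-- The expectation of `f` over the first `T` rounds under the policy `π`. -/
def expect (π : Policy N K) (T : ℕ) (f : (Fin T → Obs N K) → ℝ) : ℝ :=
  ∑ ω, (M.law π T ω).toReal * f ω

/-- `m` is a matching of the players and arms available in round `t` within the capacities. -/
def IsMatching (t : ℕ) (m : Matching N K) : Prop :=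
  (∀ i j, m i = some j → i ∈ M.players t ∧ j ∈ M.arms t) ∧
  ∀ j ∈ M.arms t, (matchedTo m j).card ≤ M.capacity t j

/-- `(i, j)` is a blocking pair for `m` in round `t`. -/
def IsBlocking (t : ℕ) (m : Matching N K) (i : Fin N) (j : Fin K) : Prop :=
  i ∈ M.players t ∧ j ∈ M.arms t ∧ M.value i (m i) < M.mean i j ∧
  ((matchedTo m j).card < M.capacity t j ∨
    ∃ i' ∈ matchedTo m j, M.rank t j i < M.rank t j i')

/-- `m` is a stable matching in round `t` (with respect to the true means). -/
def IsStable (t : ℕ) (m : Matching N K) : Prop :=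
  M.IsMatching t m ∧ ∀ i j, ¬ M.IsBlocking t m i j

/-- `m` is the player-optimal stable matching in round `t`: every available player weakly prefers
it to every stable matching. -/
def IsPlayerOptimal (t : ℕ) (m : Matching N K) : Prop :=
  M.IsStable t m ∧
  ∀ m', M.IsStable t m' → ∀ i ∈ M.players t, M.value i (m' i) ≤ M.value i (m i)

/-- The regret of player `i` over `T` rounds under the policy `π` with respect to the sequence
`mbar` of matchings (the player-optimal stable ones). -/
def regret (π : Policy N K) (mbar : ℕ → Matching N K) (T : ℕ) (i : Fin N) : ℝ :=
  ∑ t ∈ Finset.univ.filter (fun t : Fin T => i ∈ M.players t),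
    (M.value i (mbar (t : ℕ) i) - M.expect π T fun ω => reward (ω t i))

/-- The gaps `|μ_{i,j} - μ_{i,j'}|` between distinct arms that are simultaneously available in one
of the first `T` rounds in which player `i` is available; `Δ` is the least element. -/
def gaps (T : ℕ) : Set ℝ :=
  {x | ∃ t < T, ∃ i ∈ M.players t, ∃ j ∈ M.arms t, ∃ j' ∈ M.arms t,
    j ≠ j' ∧ x = |M.mean i j - M.mean i j'|}

end Market

end SleepingBandits

end

noncomputable section

namespace SleepingBandits

/-! ### Expectations over finite types -/

/-- The expectation of `f` under a probability mass function on a finite type. -/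
def finExp {α : Type} [Fintype α] (p : PMF α) (f : α → ℝ) : ℝ := ∑ a, (p a).toReal * f a

section finExp

variable {α β : Type} [Fintype α] [Fintype β]

theorem sum_toReal_eq_one (p : PMF α) : ∑ a, (p a).toReal = 1 := by
  have h := p.tsum_coe
  rw [tsum_fintype] at h
  rw [← ENNReal.toReal_sum fun a _ => p.apply_ne_top a, h, ENNReal.toReal_one]

theorem finExp_const (p : PMF α) (c : ℝ) : finExp p (fun _ => c) = c := by
  rw [finExp, ← Finset.sum_mul, sum_toReal_eq_one, one_mul]

theorem finExp_mono_support {p : PMF α} {f g : α → ℝ} (h : ∀ a, p a ≠ 0 → f a ≤ g a) :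
    finExp p f ≤ finExp p g := by
  refine Finset.sum_le_sum fun a _ => ?_
  by_cases ha : p a = 0
  · simp [ha]
  · exact mul_le_mul_of_nonneg_left (h a ha) ENNReal.toReal_nonneg

theorem finExp_mono {p : PMF α} {f g : α → ℝ} (h : ∀ a, f a ≤ g a) : finExp p f ≤ finExp p g :=
  finExp_mono_support fun a _ => h a

theorem finExp_nonneg {p : PMF α} {f : α → ℝ} (h : ∀ a, 0 ≤ f a) : 0 ≤ finExp p f :=
  Finset.sum_nonneg fun a _ => mul_nonneg ENNReal.toReal_nonneg (h a)

theorem finExp_le {p : PMF α} {f : α → ℝ} {c : ℝ} (h : ∀ a, f a ≤ c) : finExp p f ≤ c :=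
  (finExp_mono h).trans_eq (finExp_const p c)

theorem finExp_add (p : PMF α) (f g : α → ℝ) :
    finExp p (fun a => f a + g a) = finExp p f + finExp p g := by
  simp only [finExp, mul_add, Finset.sum_add_distrib]

theorem finExp_sub (p : PMF α) (f g : α → ℝ) :
    finExp p (fun a => f a - g a) = finExp p f - finExp p g := by
  simp only [finExp, mul_sub, Finset.sum_sub_distrib]

theorem finExp_const_mul (p : PMF α) (c : ℝ) (f : α → ℝ) :
    finExp p (fun a => c * f a) = c * finExp p f := by
  simp only [finExp, Finset.mul_sum, mul_left_comm]

theorem finExp_sum {ι : Type} (p : PMF α) (s : Finset ι) (f : ι → α → ℝ) :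
    finExp p (fun a => ∑ k ∈ s, f k a) = ∑ k ∈ s, finExp p (f k) := by
  simp only [finExp, Finset.mul_sum]
  exact Finset.sum_comm

theorem abs_finExp_le (p : PMF α) (f : α → ℝ) : |finExp p f| ≤ finExp p fun a => |f a| := by
  refine (Finset.abs_sum_le_sum_abs _ _).trans_eq (Finset.sum_congr rfl fun a _ => ?_)
  rw [abs_mul, abs_of_nonneg ENNReal.toReal_nonneg]

theorem finExp_pure (a : α) (f : α → ℝ) : finExp (PMF.pure a) f = f a := by
  classical
  rw [finExp, Finset.sum_eq_single a]
  · simp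
  · intro b _ hb
    simp [PMF.pure_apply, hb]
  · simp

theorem finExp_bind (p : PMF α) (q : α → PMF β) (f : β → ℝ) :
    finExp (p.bind q) f = finExp p fun a => finExp (q a) f := by
  simp only [finExp, PMF.bind_apply, Finset.mul_sum]
  rw [Finset.sum_comm]
  refine Finset.sum_congr rfl fun b _ => ?_
  rw [tsum_fintype, ENNReal.toReal_sum, Finset.sum_mul]
  · simp only [ENNReal.toReal_mul, mul_assoc]
  · exact fun a _ => ENNReal.mul_ne_top (p.apply_ne_top a) ((q a).apply_ne_top b)

theorem finExp_map (p : PMF α) (g : α → β) (f : β → ℝ) :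
    finExp (p.map g) f = finExp p fun a => f (g a) := by
  rw [PMF.map, finExp_bind]
  simp only [Function.comp_apply, finExp_pure]

/-- The marginals of a product of probability mass functions. -/
theorem finExp_piPMF_eval {N : ℕ} (p : Fin N → PMF α) (i : Fin N) (f : α → ℝ) :
    finExp (piPMF p) (fun o => f (o i)) = finExp (p i) f := by
  have key : ∀ o : Fin N → α, (piPMF p o).toReal * f (o i) =
      ∏ k, (p k (o k)).toReal * (if k = i then f (o k) else 1) := by
    intro o
    rw [Finset.prod_mul_distrib, Finset.prod_ite_eq' Finset.univ i (fun k => f (o k))]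
    simp [piPMF, ENNReal.toReal_prod]
  rw [finExp, Finset.sum_congr rfl fun o _ => key o]
  have h := Finset.prod_univ_sum (fun _ : Fin N => (Finset.univ : Finset α))
      (fun k a => (p k a).toReal * (if k = i then f a else 1))
  rw [Fintype.piFinset_univ] at h
  rw [← h, Finset.prod_eq_single i]
  · simp [finExp]
  · intro k _ hk
    simp [hk, sum_toReal_eq_one]
  · simp

theorem finExp_bernoulliPMF (p : ℝ) (h0 : 0 ≤ p) (h1 : p ≤ 1) (f : Bool → ℝ) :
    finExp (bernoulliPMF p h0 h1) f = p * f true + (1 - p) * f false := by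
  simp [finExp, bernoulliPMF, ENNReal.toReal_ofReal h0, ENNReal.toReal_ofReal (sub_nonneg.2 h1)]

theorem finExp_uniformOfFinset (s : Finset α) (hs : s.Nonempty) (f : α → ℝ) :
    finExp (PMF.uniformOfFinset s hs) f = (∑ a ∈ s, f a) / s.card := by
  classical
  rw [finExp, ← Finset.sum_subset (Finset.subset_univ s), Finset.sum_div]
  · refine Finset.sum_congr rfl fun a ha => ?_
    rw [PMF.uniformOfFinset_apply_of_mem hs ha, ENNReal.toReal_inv, ENNReal.toReal_natCast]
    ring
  · intro a _ ha
    rw [PMF.uniformOfFinset_apply_of_notMem hs ha]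
    simp

end finExp

/-! ### The law of the process -/

namespace Market

variable {N K : ℕ} (M : Market N K)

theorem finExp_law_succ (π : Policy N K) (t : ℕ) (f : (Fin (t + 1) → Obs N K) → ℝ) :
    finExp (M.law π (t + 1)) f = finExp (M.law π t) fun h => finExp (π t h) fun m =>
      finExp (M.roundLaw m) fun o => f (Fin.snoc (α := fun _ => Obs N K) h o) := by
  simp only [law, finExp_bind, finExp_map]

theorem finExp_law_castLE (π : Policy N K) {t T : ℕ} (h : t ≤ T) (g : (Fin t → Obs N K) → ℝ) :
    finExp (M.law π T) (fun ω => g fun s => ω (Fin.castLE h s)) = finExp (M.law π t) g := by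
  induction T, h using Nat.le_induction with
  | base => rfl
  | succ T h ih =>
    rw [finExp_law_succ, ← ih]
    refine congrArg _ (funext fun ω => ?_)
    have : ∀ o : Obs N K, (fun s : Fin t => (Fin.snoc (α := fun _ => Obs N K) ω o : Fin (T + 1) → _)
        (Fin.castLE (h.trans (Nat.le_succ T)) s)) = fun s => ω (Fin.castLE h s) := by
      intro o
      funext s
      exact Fin.snoc_castSucc (α := fun _ => Obs N K) o ω (Fin.castLE h s)
    simp only [this, finExp_const]

theorem finExp_roundLaw_eval (m : Matching N K) (i : Fin N) (f : Option (Fin K × Bool) → ℝ) :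
    finExp (M.roundLaw m) (fun o => f (o i)) = finExp (M.playerLaw i (m i)) f :=
  finExp_piPMF_eval _ i f

theorem finExp_playerLaw_none (i : Fin N) (f : Option (Fin K × Bool) → ℝ) :
    finExp (M.playerLaw i none) f = f none := finExp_pure _ _

theorem finExp_playerLaw_some (i : Fin N) (j : Fin K) (f : Option (Fin K × Bool) → ℝ) :
    finExp (M.playerLaw i (some j)) f =
      M.mean i j * f (some (j, true)) + (1 - M.mean i j) * f (some (j, false)) := by
  rw [playerLaw, finExp_map, finExp_bernoulliPMF]

theorem finExp_playerLaw_reward (i : Fin N) (a : Option (Fin K)) :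
    finExp (M.playerLaw i a) reward = M.value i a := by
  cases a with
  | none => simp [finExp_playerLaw_none, reward, value]
  | some j => simp [finExp_playerLaw_some, reward, value]

/-- The expected reward of a round is the expected value of the matching chosen. -/
theorem expect_reward (π : Policy N K) (T : ℕ) (t : Fin T) (i : Fin N) :
    M.expect π T (fun ω => reward (ω t i)) =
      finExp (M.law π t) fun h => finExp (π t h) fun m => M.value i (m i) := by
  have := M.finExp_law_castLE π (Nat.succ_le_of_lt t.2)
    (fun h : Fin (t + 1) → Obs N K => reward (h (Fin.last t) i))
  refine this.trans ?_
  rw [finExp_law_succ]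
  simp only [Fin.snoc_last, finExp_roundLaw_eval M _ i reward, finExp_playerLaw_reward]

theorem value_nonneg (i : Fin N) (a : Option (Fin K)) : 0 ≤ M.value i a := by
  cases a with
  | none => exact le_rfl
  | some j => exact (M.mean_pos i j).le

theorem value_le_one (i : Fin N) (a : Option (Fin K)) : M.value i a ≤ 1 := by
  cases a with
  | none => exact zero_le_one
  | some j => exact (M.mean_lt_one i j).le

end Market

/-! ### Correctness of the Gale--Shapley algorithm -/

variable {N K : ℕ}

theorem mem_matchedTo {m : Matching N K} {a : Fin K} {i : Fin N} :
    i ∈ matchedTo m a ↔ m i = some a := by simp [matchedTo]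

namespace Market

variable (M : Market N K) {t : ℕ}

theorem stable_ne_of_full {m m' : Matching N K} {a : Fin K} {x : Fin N} (ha : a ∈ M.arms t)
    (hfull : M.capacity t a ≤ (matchedTo m a).card)
    (hm : ∀ y ∈ matchedTo m a, y ∈ M.players t ∧ M.rank t a y < M.rank t a x ∧
      ∀ b ∈ M.arms t, M.mean y a < M.mean y b → m' y ≠ some b)
    (hs : M.IsStable t m') : m' x ≠ some a := by
  intro hx
  have hx' : x ∈ matchedTo m' a := mem_matchedTo.2 hx
  obtain ⟨y, hy, hy'⟩ : ∃ y ∈ matchedTo m a, y ∉ matchedTo m' a := by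
    by_contra! hsub
    have hlt : (matchedTo m a).card < (matchedTo m' a).card := by
      refine Finset.card_lt_card ⟨hsub, fun h => ?_⟩
      exact lt_irrefl _ (hm x (h hx')).2.1
    exact absurd (hs.1.2 a ha) (not_le.2 (hfull.trans_lt hlt))
  obtain ⟨hyP, hyr, hyb⟩ := hm y hy
  refine hs.2 y a ⟨hyP, ha, ?_, Or.inr ⟨x, hx', hyr⟩⟩
  cases hc : m' y with
  | none => exact M.mean_pos y a
  | some b =>
    have hb := (hs.1.1 y b hc).2
    have hba : b ≠ a := fun h => hy' (mem_matchedTo.2 (h ▸ hc))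
    exact lt_of_le_of_ne (not_lt.1 fun h => hyb b hb h hc) (M.mean_ne t y hyP b hb a ha hba)

theorem eq_of_isPlayerOptimal {m m' : Matching N K} (h : M.IsPlayerOptimal t m)
    (h' : M.IsPlayerOptimal t m') : m = m' := by
  funext i
  by_cases hi : i ∈ M.players t
  · have hv := le_antisymm (h'.2 m h.1 i hi) (h.2 m' h'.1 i hi)
    cases hm : m i with
    | none =>
      cases hm' : m' i with
      | none => rfl
      | some b =>
        rw [hm, hm'] at hv
        exact absurd hv (M.mean_pos i b).ne
    | some a =>
      cases hm' : m' i with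
      | none =>
        rw [hm, hm'] at hv
        exact absurd hv (M.mean_pos i a).ne'
      | some b =>
        rw [hm, hm'] at hv
        by_contra hab
        exact M.mean_ne t i hi a (h.1.1.1 i a hm).2 b (h'.1.1.1 i b hm').2
          (fun e => hab (congrArg some e)) hv
  · have key : ∀ {m : Matching N K}, M.IsPlayerOptimal t m → m i = none := by
      intro m h
      cases hm : m i with
      | none => rfl
      | some a => exact absurd (h.1.1.1 i a hm).1 hi
    rw [key h, key h']

end Market

/-- `L i` lists the available arms by decreasing mean reward for every available player `i`. -/
def IsPrefList (M : Market N K) (t : ℕ) (L : Fin N → List (Fin K)) : Prop :=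
  ∀ i ∈ M.players t, (∀ a, a ∈ L i ↔ a ∈ M.arms t) ∧
    (L i).Pairwise fun a b => M.mean i b < M.mean i a

/-- In the state `s`, player `i` has proposed to `a` but is not matched to it. -/
def Rejected (L : Fin N → List (Fin K)) (s : GSState N K) (i : Fin N) (a : Fin K) : Prop :=
  a ∈ L i ∧ a ∉ s.todo i ∧ s.assigned i ≠ some a

/-- The loop invariant of the Gale--Shapley algorithm. -/
structure GSInv (M : Market N K) (t : ℕ) (L : Fin N → List (Fin K)) (s : GSState N K) : Prop where
  free_subset : s.free ⊆ M.players t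
  todo_suffix : ∀ i, s.todo i <:+ L i
  assigned_mem : ∀ i a, s.assigned i = some a →
    i ∈ M.players t ∧ i ∉ s.free ∧ a ∈ L i ∧ a ∉ s.todo i
  card_le : ∀ a, (matchedTo s.assigned a).card ≤ M.capacity t a
  todo_eq_nil : ∀ i ∈ M.players t, i ∉ s.free → s.assigned i = none → s.todo i = []
  assigned_le : ∀ i a, s.assigned i = some a → ∀ b ∈ L i, b ∉ s.todo i → M.mean i a ≤ M.mean i b
  full : ∀ i ∈ M.players t, ∀ a, Rejected L s i a →
    M.capacity t a ≤ (matchedTo s.assigned a).card ∧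
      ∀ q ∈ matchedTo s.assigned a, M.rank t a q < M.rank t a i
  not_stable : ∀ i ∈ M.players t, ∀ a, Rejected L s i a → ∀ m', M.IsStable t m' → m' i ≠ some a

theorem lt_of_mem_suffix {M : Market N K} {t : ℕ} {L : Fin N → List (Fin K)}
    (hL : IsPrefList M t L) {i : Fin N} (hi : i ∈ M.players t) {l : List (Fin K)}
    (hl : l <:+ L i) {a b : Fin K} (ha : a ∈ L i) (hal : a ∉ l) (hb : b ∈ l) :
    M.mean i b < M.mean i a := by
  obtain ⟨pre, hpre⟩ := hl
  have hp := (hL i hi).2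
  rw [← hpre, List.pairwise_append] at hp
  rw [← hpre, List.mem_append] at ha
  exact hp.2.2 a (ha.resolve_right hal) b hb

theorem notMem_tail_of_suffix {M : Market N K} {t : ℕ} {L : Fin N → List (Fin K)}
    (hL : IsPrefList M t L) {i : Fin N} (hi : i ∈ M.players t) {a : Fin K} {l : List (Fin K)}
    (hl : a :: l <:+ L i) : a ∉ l := by
  intro h
  have hp := (hL i hi).2.sublist hl.sublist
  exact lt_irrefl _ ((List.pairwise_cons.1 hp).1 a h)

namespace GSInv

variable {M : Market N K} {t : ℕ} {L : Fin N → List (Fin K)} {s : GSState N K}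

/-- A newly rejected proposal does not belong to any stable matching. -/
theorem stable_ne_of_step {s' : GSState N K} {a : Fin K} {x : Fin N} (hL : IsPrefList M t L)
    (h : GSInv M t L s) (haA : a ∈ M.arms t)
    (hsuf : ∀ i, s'.todo i <:+ L i)
    (hmem : ∀ i a, s'.assigned i = some a →
      i ∈ M.players t ∧ i ∉ s'.free ∧ a ∈ L i ∧ a ∉ s'.todo i)
    (hrej : ∀ i ∈ M.players t, ∀ b, Rejected L s' i b → (i = x ∧ b = a) ∨ Rejected L s i b)
    (hfull : M.capacity t a ≤ (matchedTo s'.assigned a).card)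
    (hrank : ∀ q ∈ matchedTo s'.assigned a, M.rank t a q < M.rank t a x) :
    ∀ i ∈ M.players t, ∀ b, Rejected L s' i b → ∀ m', M.IsStable t m' → m' i ≠ some b := by
  intro i hi b hb m' hm'
  rcases hrej i hi b hb with ⟨rfl, rfl⟩ | hold
  · refine M.stable_ne_of_full haA hfull (fun y hy => ?_) hm'
    obtain ⟨hyP, -, hyL, hyt⟩ := hmem y b (mem_matchedTo.1 hy)
    refine ⟨hyP, hrank y hy, fun c hc hlt => ?_⟩
    have hcr : Rejected L s' y c := by
      refine ⟨((hL y hyP).1 c).2 hc, fun hct => ?_, fun hyc => ?_⟩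
      · exact lt_asymm hlt (lt_of_mem_suffix hL hyP (hsuf y) hyL hyt hct)
      · rw [mem_matchedTo.1 hy, Option.some.injEq] at hyc
        exact lt_irrefl _ (hyc ▸ hlt)
    rcases hrej y hyP c hcr with ⟨-, hcb⟩ | hold
    · exact absurd hlt (hcb ▸ lt_irrefl _)
    · exact h.not_stable y hyP c hold m' hm'
  · exact h.not_stable i hi b hold m' hm'

theorem init (M : Market N K) (t : ℕ) (L : Fin N → List (Fin K)) :
    GSInv M t L { free := M.players t, todo := L, assigned := fun _ => none } where
  free_subset := subset_rfl
  todo_suffix _ := List.suffix_rfl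
  assigned_mem _ _ h := by simp at h
  card_le a := by simp [matchedTo]
  todo_eq_nil i hi hi' := absurd hi hi'
  assigned_le _ _ h := by simp at h
  full i _ a h := absurd h.1 h.2.1
  not_stable i _ a h := absurd h.1 h.2.1

/-- A free player with no proposals left is removed. -/
theorem erase (h : GSInv M t L s) {p : Fin N} (hp : s.todo p = []) :
    GSInv M t L { s with free := s.free.erase p } where
  free_subset := (Finset.erase_subset _ _).trans h.free_subset
  todo_suffix := h.todo_suffix
  assigned_mem i a hi := by
    obtain ⟨h1, h2, h3⟩ := h.assigned_mem i a hi
    exact ⟨h1, fun h' => h2 (Finset.mem_of_mem_erase h'), h3⟩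
  card_le := h.card_le
  todo_eq_nil i hi hif hia := by
    by_cases hip : i = p
    · exact hip ▸ hp
    · exact h.todo_eq_nil i hi (fun h' => hif (Finset.mem_erase.2 ⟨hip, h'⟩)) hia
  assigned_le := h.assigned_le
  full := h.full
  not_stable := h.not_stable

theorem todo_update_suffix (h : GSInv M t L s) {p : Fin N} {a : Fin K} {l : List (Fin K)}
    (hp : s.todo p = a :: l) (i : Fin N) : Function.update s.todo p l i <:+ L i := by
  by_cases hip : i = p
  · subst hip
    rw [Function.update_self]
    exact (List.suffix_cons a l).trans (hp ▸ h.todo_suffix i)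
  · rw [Function.update_of_ne hip]
    exact h.todo_suffix i

theorem assigned_eq_none_of_mem_free (h : GSInv M t L s) {p : Fin N} (hp : p ∈ s.free) :
    s.assigned p = none := by
  cases hc : s.assigned p with
  | none => rfl
  | some a => exact absurd hp (h.assigned_mem p a hc).2.1

/-- An arm with a vacancy accepts a proposal. -/
theorem accept (hL : IsPrefList M t L) (h : GSInv M t L s) {p : Fin N} (hpf : p ∈ s.free)
    {a : Fin K} {l : List (Fin K)} (hp : s.todo p = a :: l)
    (hcard : (matchedTo s.assigned a).card < M.capacity t a) :
    GSInv M t L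
      { free := s.free.erase p
        todo := Function.update s.todo p l
        assigned := Function.update s.assigned p (some a) } := by
  have hpP := h.free_subset hpf
  have hnone := h.assigned_eq_none_of_mem_free hpf
  have hsuf : a :: l <:+ L p := hp ▸ h.todo_suffix p
  have haL : a ∈ L p := hsuf.subset List.mem_cons_self
  have hal := notMem_tail_of_suffix hL hpP hsuf
  have hmatch : matchedTo (Function.update s.assigned p (some a)) a =
      insert p (matchedTo s.assigned a) := by
    ext i
    rw [Finset.mem_insert, mem_matchedTo, mem_matchedTo]
    by_cases hip : i = p
    · simp [hip]
    · simp [hip]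
  have hmatch' : ∀ b ≠ a, matchedTo (Function.update s.assigned p (some a)) b =
      matchedTo s.assigned b := by
    intro b hb
    ext i
    rw [mem_matchedTo, mem_matchedTo]
    by_cases hip : i = p
    · simp [hip, hnone, hb.symm]
    · simp [hip]
  have hrej : ∀ i ∈ M.players t, ∀ b, Rejected L
      { free := s.free.erase p
        todo := Function.update s.todo p l
        assigned := Function.update s.assigned p (some a) } i b → b ≠ a ∧ Rejected L s i b := by
    rintro i hi b ⟨h1, h2, h3⟩
    have hold : Rejected L s i b := by
      by_cases hip : i = p
      · subst hip
        simp only [Function.update_self, ne_eq, Option.some.injEq] at h2 h3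
        refine ⟨h1, ?_, by simp [hnone]⟩
        rw [hp, List.mem_cons]
        rintro (rfl | hb)
        · exact h3 rfl
        · exact h2 hb
      · simp only [Function.update_of_ne hip] at h2 h3
        exact ⟨h1, h2, h3⟩
    refine ⟨?_, hold⟩
    rintro rfl
    exact absurd (h.full i hi b hold).1 (not_le.2 hcard)
  refine ⟨(Finset.erase_subset _ _).trans h.free_subset, h.todo_update_suffix hp, ?_, ?_, ?_, ?_,
    ?_, fun i hi b hb => h.not_stable i hi b (hrej i hi b hb).2⟩
  · intro i b hib
    by_cases hip : i = p
    · subst hip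
      simp only [Function.update_self, Option.some.injEq] at hib ⊢
      subst hib
      exact ⟨hpP, by simp, haL, hal⟩
    · simp only [Function.update_of_ne hip] at hib ⊢
      obtain ⟨h1, h2, h3⟩ := h.assigned_mem i b hib
      exact ⟨h1, fun h' => h2 (Finset.mem_of_mem_erase h'), h3⟩
  · intro b
    by_cases hb : b = a
    · subst hb
      simp only [hmatch]
      exact (Finset.card_insert_le _ _).trans hcard
    · simp only [hmatch' b hb]
      exact h.card_le b
  · intro i hi hif hia
    by_cases hip : i = p
    · simp [hip] at hia
    · simp only [Function.update_of_ne hip] at hia ⊢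
      exact h.todo_eq_nil i hi (fun h' => hif (Finset.mem_erase.2 ⟨hip, h'⟩)) hia
  · intro i b hib c hc hct
    by_cases hip : i = p
    · subst hip
      simp only [Function.update_self, Option.some.injEq] at hib hct
      subst hib
      by_cases hcb : c = a
      · rw [hcb]
      · refine (lt_of_mem_suffix hL hpP hsuf hc ?_ List.mem_cons_self).le
        simp [hcb, hct]
    · simp only [Function.update_of_ne hip] at hib hct
      exact h.assigned_le i b hib c hc hct
  · intro i hi b hb
    obtain ⟨hba, hold⟩ := hrej i hi b hb
    simp only [hmatch' b hba]
    exact h.full i hi b hold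

/-- A full arm rejects a proposal. -/
theorem reject (hL : IsPrefList M t L) (h : GSInv M t L s) {p : Fin N} (hpf : p ∈ s.free)
    {a : Fin K} {l : List (Fin K)} (hp : s.todo p = a :: l)
    (hcard : M.capacity t a ≤ (matchedTo s.assigned a).card)
    (hrank : ∀ q ∈ matchedTo s.assigned a, M.rank t a q < M.rank t a p) :
    GSInv M t L { s with todo := Function.update s.todo p l } := by
  have hpP := h.free_subset hpf
  have hnone := h.assigned_eq_none_of_mem_free hpf
  have hsuf : a :: l <:+ L p := hp ▸ h.todo_suffix p
  have haL : a ∈ L p := hsuf.subset List.mem_cons_self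
  have hrej : ∀ i ∈ M.players t, ∀ b, Rejected L { s with todo := Function.update s.todo p l } i b →
      (i = p ∧ b = a) ∨ Rejected L s i b := by
    rintro i hi b ⟨h1, h2, h3⟩
    by_cases hip : i = p
    · subst hip
      simp only [Function.update_self] at h2
      by_cases hba : b = a
      · exact Or.inl ⟨rfl, hba⟩
      · exact Or.inr ⟨h1, by simp [hp, hba, h2], h3⟩
    · simp only [Function.update_of_ne hip] at h2
      exact Or.inr ⟨h1, h2, h3⟩
  have hne : ∀ {i b}, s.assigned i = some b → i ≠ p := by
    rintro i b hib rfl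
    rw [hnone] at hib
    cases hib
  have hmem : ∀ i b, s.assigned i = some b →
      i ∈ M.players t ∧ i ∉ s.free ∧ b ∈ L i ∧ b ∉ Function.update s.todo p l i := by
    intro i b hib
    rw [Function.update_of_ne (hne hib)]
    exact h.assigned_mem i b hib
  refine ⟨h.free_subset, h.todo_update_suffix hp, hmem, h.card_le, ?_, ?_, ?_,
    h.stable_ne_of_step hL (((hL p hpP).1 a).1 haL) (h.todo_update_suffix hp) hmem hrej hcard
      hrank⟩
  · intro i hi hif hia
    have hip : i ≠ p := fun e => hif (e ▸ hpf)
    simp only [Function.update_of_ne hip]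
    exact h.todo_eq_nil i hi hif hia
  · intro i b hib c hc hct
    simp only [Function.update_of_ne (hne hib)] at hct
    exact h.assigned_le i b hib c hc hct
  · intro i hi b hb
    rcases hrej i hi b hb with ⟨rfl, rfl⟩ | hold
    · exact ⟨hcard, hrank⟩
    · exact h.full i hi b hold

/-- A full arm accepts a proposal and rejects the worst of its players. -/
theorem swap (hL : IsPrefList M t L) (h : GSInv M t L s) {p q : Fin N} (hpf : p ∈ s.free)
    {a : Fin K} {l : List (Fin K)} (hp : s.todo p = a :: l)
    (hcard : M.capacity t a ≤ (matchedTo s.assigned a).card)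
    (hq : q ∈ matchedTo s.assigned a)
    (hworst : ∀ q' ∈ matchedTo s.assigned a, M.rank t a q' ≤ M.rank t a q)
    (hpq : M.rank t a p < M.rank t a q) :
    GSInv M t L
      { free := insert q (s.free.erase p)
        todo := Function.update s.todo p l
        assigned := Function.update (Function.update s.assigned q none) p (some a) } := by
  have hpP := h.free_subset hpf
  have hnone := h.assigned_eq_none_of_mem_free hpf
  have hsuf : a :: l <:+ L p := hp ▸ h.todo_suffix p
  have haL : a ∈ L p := hsuf.subset List.mem_cons_self
  have hal := notMem_tail_of_suffix hL hpP hsuf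
  have haA := ((hL p hpP).1 a).1 haL
  have hqa := mem_matchedTo.1 hq
  obtain ⟨hqP, hqf, hqL, hqt⟩ := h.assigned_mem q a hqa
  have hqp : q ≠ p := fun e => hqf (e ▸ hpf)
  set asg := Function.update (Function.update s.assigned q none) p (some a) with hasg
  have hasgp : asg p = some a := by simp [hasg]
  have hasgq : asg q = none := by simp [hasg, hqp]
  have hasgi : ∀ i, i ≠ p → i ≠ q → asg i = s.assigned i := by
    intro i h1 h2
    simp [hasg, h1, h2]
  have hmatch : matchedTo asg a = insert p ((matchedTo s.assigned a).erase q) := by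
    ext i
    rw [Finset.mem_insert, Finset.mem_erase, mem_matchedTo, mem_matchedTo]
    by_cases hip : i = p
    · simp [hip, hasgp]
    · by_cases hiq : i = q
      · simp [hiq, hasgq, hqp]
      · simp [hip, hiq, hasgi i hip hiq]
  have hmatch' : ∀ b ≠ a, matchedTo asg b = matchedTo s.assigned b := by
    intro b hb
    ext i
    rw [mem_matchedTo, mem_matchedTo]
    by_cases hip : i = p
    · simp [hip, hnone, hb.symm, hasgp]
    · by_cases hiq : i = q
      · simp [hiq, hasgq, hqa, hb.symm]
      · rw [hasgi i hip hiq]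
  have hcardeq : (matchedTo asg a).card = (matchedTo s.assigned a).card := by
    rw [hmatch, Finset.card_insert_of_notMem, Finset.card_erase_add_one hq]
    intro hp'
    have := mem_matchedTo.1 (Finset.mem_of_mem_erase hp')
    rw [hnone] at this
    cases this
  have hrank : ∀ q' ∈ matchedTo asg a, M.rank t a q' < M.rank t a q := by
    intro q' hq'
    rw [hmatch, Finset.mem_insert, Finset.mem_erase] at hq'
    rcases hq' with rfl | ⟨hne, hq'⟩
    · exact hpq
    · refine lt_of_le_of_ne (hworst q' hq') fun e => hne ?_
      exact M.rank_injOn t a haA (h.assigned_mem q' a (mem_matchedTo.1 hq')).1 hqP e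
  have hrej : ∀ i ∈ M.players t, ∀ b, Rejected L
      { free := insert q (s.free.erase p)
        todo := Function.update s.todo p l
        assigned := asg } i b → (i = q ∧ b = a) ∨ Rejected L s i b := by
    rintro i hi b ⟨h1, h2, h3⟩
    by_cases hip : i = p
    · subst hip
      simp only [Function.update_self, hasgp, ne_eq, Option.some.injEq] at h2 h3
      refine Or.inr ⟨h1, ?_, by simp [hnone]⟩
      rw [hp, List.mem_cons]
      rintro (rfl | hb)
      · exact h3 rfl
      · exact h2 hb
    · simp only [Function.update_of_ne hip] at h2
      by_cases hiq : i = q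
      · subst hiq
        by_cases hba : b = a
        · exact Or.inl ⟨rfl, hba⟩
        · exact Or.inr ⟨h1, h2, by simp [hqa, Ne.symm hba]⟩
      · exact Or.inr ⟨h1, h2, hasgi i hip hiq ▸ h3⟩
  have hcases : ∀ i b, asg i = some b →
      (i = p ∧ b = a) ∨ (i ≠ p ∧ i ≠ q ∧ s.assigned i = some b) := by
    intro i b hib
    by_cases hip : i = p
    · subst hip
      rw [hasgp, Option.some.injEq] at hib
      exact Or.inl ⟨rfl, hib.symm⟩
    · by_cases hiq : i = q
      · rw [hiq, hasgq] at hib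
        cases hib
      · exact Or.inr ⟨hip, hiq, hasgi i hip hiq ▸ hib⟩
  have hmem : ∀ i b, asg i = some b → i ∈ M.players t ∧ i ∉ insert q (s.free.erase p) ∧
      b ∈ L i ∧ b ∉ Function.update s.todo p l i := by
    intro i b hib
    rcases hcases i b hib with ⟨rfl, rfl⟩ | ⟨hip, hiq, hib⟩
    · exact ⟨hpP, by simp [hqp.symm], haL, by simpa using hal⟩
    · rw [Function.update_of_ne hip]
      obtain ⟨h1, h2, h3⟩ := h.assigned_mem i b hib
      exact ⟨h1, by simp [hiq, h2], h3⟩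
  refine ⟨?_, h.todo_update_suffix hp, hmem, ?_, ?_, ?_, ?_,
    h.stable_ne_of_step hL haA (h.todo_update_suffix hp) hmem hrej
      (hcard.trans_eq hcardeq.symm) hrank⟩
  · exact Finset.insert_subset hqP ((Finset.erase_subset _ _).trans h.free_subset)
  · intro b
    by_cases hb : b = a
    · subst hb
      exact hcardeq.trans_le (h.card_le b)
    · simp only [hmatch' b hb]
      exact h.card_le b
  · intro i hi hif hia
    simp only [Finset.mem_insert, Finset.mem_erase, not_or, not_and] at hif
    by_cases hip : i = p
    · subst hip
      rw [show asg i = none from hia] at hasgp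
      cases hasgp
    · simp only [Function.update_of_ne hip]
      exact h.todo_eq_nil i hi (hif.2 hip) (hasgi i hip hif.1 ▸ hia)
  · intro i b hib c hc hct
    rcases hcases i b hib with ⟨rfl, rfl⟩ | ⟨hip, hiq, hib⟩
    · simp only [Function.update_self] at hct
      by_cases hcb : c = b
      · rw [hcb]
      · refine (lt_of_mem_suffix hL hpP hsuf hc ?_ List.mem_cons_self).le
        simp [hcb, hct]
    · simp only [Function.update_of_ne hip] at hct
      exact h.assigned_le i b hib c hc hct
  · intro i hi b hb
    rcases hrej i hi b hb with ⟨rfl, rfl⟩ | hold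
    · exact ⟨hcard.trans_eq hcardeq.symm, hrank⟩
    · by_cases hba : b = a
      · subst hba
        have hf := h.full i hi b hold
        exact ⟨hcard.trans_eq hcardeq.symm, fun q' hq' => (hrank q' hq').trans (hf.2 q hq)⟩
      · simp only [hmatch' b hba]
        exact h.full i hi b hold

theorem step (hL : IsPrefList M t L) (h : GSInv M t L s) :
    GSInv M t L (gsStep (M.rank t) (M.capacity t) s) := by
  by_cases hfree : s.free.Nonempty
  · have hpf := s.free.min'_mem hfree
    simp only [gsStep, dif_pos hfree]
    split
    · next hnil => exact h.erase hnil
    · next a l hcons =>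
      split_ifs with hcard hw
      · exact h.accept hL hpf hcons hcard
      · exact h.swap hL hpf hcons (not_lt.1 hcard) hw.choose_spec.1 hw.choose_spec.2.1
          hw.choose_spec.2.2
      · have hpP := h.free_subset hpf
        have haA : a ∈ M.arms t := ((hL _ hpP).1 a).1
          ((hcons ▸ h.todo_suffix (s.free.min' hfree) : a :: l <:+ _).subset List.mem_cons_self)
        have hne : (matchedTo s.assigned a).Nonempty := by
          rw [← Finset.card_pos]
          exact (M.capacity_pos t a haA).trans (not_lt.1 hcard)
        obtain ⟨q, hq, hworst⟩ := Finset.exists_max_image _ (M.rank t a) hne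
        refine h.reject hL hpf hcons (not_lt.1 hcard) fun q' hq' => (hworst q' hq').trans_lt ?_
        obtain ⟨hqP, hqf, -⟩ := h.assigned_mem q a (mem_matchedTo.1 hq)
        refine lt_of_le_of_ne (not_lt.1 fun hlt => hw ⟨q, hq, hworst, hlt⟩) fun e => hqf ?_
        rw [M.rank_injOn t a haA hqP hpP e]
        exact hpf
  · simpa only [gsStep, dif_neg hfree] using h

theorem isPlayerOptimal (hL : IsPrefList M t L) (h : GSInv M t L s) (hfree : s.free = ∅) :
    M.IsPlayerOptimal t s.assigned := by
  have hbetter : ∀ i ∈ M.players t, ∀ b ∈ s.todo i, M.mean i b < M.value i (s.assigned i) := by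
    intro i hi b hb
    cases hc : s.assigned i with
    | none =>
      rw [h.todo_eq_nil i hi (by simp [hfree]) hc] at hb
      cases hb
    | some a =>
      obtain ⟨-, -, haL, hat⟩ := h.assigned_mem i a hc
      exact lt_of_mem_suffix hL hi (h.todo_suffix i) haL hat hb
  refine ⟨⟨⟨fun i a hia => ?_, fun a _ => h.card_le a⟩, ?_⟩, ?_⟩
  · obtain ⟨hi, -, haL, -⟩ := h.assigned_mem i a hia
    exact ⟨hi, ((hL i hi).1 a).1 haL⟩
  · rintro i a ⟨hi, ha, hlt, hv⟩
    have hr : Rejected L s i a := by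
      refine ⟨((hL i hi).1 a).2 ha, fun hat => lt_asymm hlt (hbetter i hi a hat), fun hia => ?_⟩
      rw [hia] at hlt
      exact lt_irrefl _ hlt
    obtain ⟨h1, h2⟩ := h.full i hi a hr
    rcases hv with hv | ⟨q, hq, hlt'⟩
    · exact absurd h1 (not_le.2 hv)
    · exact lt_asymm hlt' (h2 q hq)
  · intro m' hm' i hi
    cases hc : m' i with
    | none => exact M.value_nonneg i _
    | some b =>
      have hb := (hm'.1.1 i b hc).2
      by_cases hbt : b ∈ s.todo i
      · exact (hbetter i hi b hbt).le
      · by_cases hib : s.assigned i = some b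
        · rw [hib]
        · exact absurd hc (h.not_stable i hi b ⟨((hL i hi).1 b).2 hb, hbt, hib⟩ m' hm')

end GSInv

/-! ### Termination -/

/-- The number of proposals and removals which can still be made. -/
def gsPotential (s : GSState N K) : ℕ :=
  ∑ i, (s.todo i).length + (s.free ∪ Finset.univ.filter fun i => s.assigned i ≠ none).card

theorem sum_length_update {todo : Fin N → List (Fin K)} {p : Fin N} {a : Fin K}
    {l : List (Fin K)} (hp : todo p = a :: l) :
    ∑ i, (Function.update todo p l i).length + 1 = ∑ i, (todo i).length := by
  rw [← Finset.add_sum_erase _ _ (Finset.mem_univ p),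
    ← Finset.add_sum_erase _ (fun i => (todo i).length) (Finset.mem_univ p), hp,
    Finset.sum_congr rfl fun i hi => by rw [Function.update_of_ne (Finset.ne_of_mem_erase hi)]]
  simp
  omega

theorem gsPotential_step {rank : Fin K → Fin N → ℕ} {capacity : Fin K → ℕ} {s : GSState N K}
    (hs : ∀ i ∈ s.free, s.assigned i = none) (hfree : s.free.Nonempty) :
    gsPotential (gsStep rank capacity s) + 1 ≤ gsPotential s := by
  have hpf := s.free.min'_mem hfree
  simp only [gsStep, dif_pos hfree]
  set p := s.free.min' hfree with hp
  have hnone := hs p hpf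
  split
  · simp only [gsPotential, add_assoc]
    refine Nat.add_le_add_left (Finset.card_lt_card ?_) _
    refine ⟨Finset.union_subset_union_left (Finset.erase_subset _ _), fun hsub => ?_⟩
    have := hsub (Finset.mem_union_left _ hpf)
    simp [hnone] at this
  · next a l hcons =>
    have hlen := sum_length_update hcons
    split_ifs with hcard hw
    · simp only [gsPotential]
      have : (s.free.erase p ∪ Finset.univ.filter fun i =>
          Function.update s.assigned p (some a) i ≠ none).card ≤
          (s.free ∪ Finset.univ.filter fun i => s.assigned i ≠ none).card := by
        refine Finset.card_le_card fun i hi => ?_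
        by_cases hip : i = p
        · exact Finset.mem_union_left _ (hip ▸ hpf)
        · simpa [hip] using hi
      omega
    · simp only [gsPotential]
      have hq := mem_matchedTo.1 hw.choose_spec.1
      set q := hw.choose
      have : (insert q (s.free.erase p) ∪ Finset.univ.filter fun i =>
          Function.update (Function.update s.assigned q none) p (some a) i ≠ none).card ≤
          (s.free ∪ Finset.univ.filter fun i => s.assigned i ≠ none).card := by
        refine Finset.card_le_card fun i hi => ?_
        by_cases hip : i = p
        · exact Finset.mem_union_left _ (hip ▸ hpf)
        · by_cases hiq : i = q
          · rw [hiq]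
            simp [hq]
          · simpa [hip, hiq] using hi
      omega
    · simp only [gsPotential]
      omega

theorem galeShapley_isPlayerOptimal {M : Market N K} {t : ℕ} {L : Fin N → List (Fin K)}
    (hL : IsPrefList M t L) (hlen : ∀ i, (L i).length ≤ K) :
    M.IsPlayerOptimal t (galeShapley (M.players t) L (M.rank t) (M.capacity t)) := by
  set s₀ : GSState N K := { free := M.players t, todo := L, assigned := fun _ => none } with hs₀
  set f := gsStep (M.rank t) (M.capacity t) with hf
  have hinv : ∀ n, GSInv M t L (f^[n] s₀) := by
    intro n
    induction n with
    | zero => exact GSInv.init M t L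
    | succ n ih =>
      rw [Function.iterate_succ_apply']
      exact ih.step hL
  have hpot : ∀ n, (f^[n] s₀).free = ∅ ∨ gsPotential (f^[n] s₀) + n ≤ gsPotential s₀ := by
    intro n
    induction n with
    | zero => exact Or.inr le_rfl
    | succ n ih =>
      rw [Function.iterate_succ_apply']
      rcases Finset.eq_empty_or_nonempty (f^[n] s₀).free with he | hne
      · left
        rw [hf, gsStep, dif_neg (by simp [← hf, he]), ← hf, he]
      · right
        have h1 := gsPotential_step (rank := M.rank t) (capacity := M.capacity t)
          (fun i hi => (hinv n).assigned_eq_none_of_mem_free hi) hne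
        have h2 := ih.resolve_left hne.ne_empty
        rw [← hf] at h1
        omega
  have hinit : gsPotential s₀ ≤ N * (K + 1) := by
    have h1 : ∑ i, (L i).length ≤ N * K := by
      simpa using Finset.sum_le_card_nsmul Finset.univ _ K fun i _ => hlen i
    have h2 : (M.players t).card ≤ N := by simpa using (M.players t).card_le_univ
    simp only [gsPotential, hs₀, ne_eq, not_true_eq_false, Finset.filter_false, Finset.union_empty]
    rw [mul_add, mul_one]
    omega
  refine (hinv (N * (K + 1))).isPlayerOptimal hL ?_
  rcases hpot (N * (K + 1)) with he | hle
  · exact he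
  · have h0 : gsPotential (f^[N * (K + 1)] s₀) = 0 := by omega
    have := (Nat.add_eq_zero_iff.1 h0).2
    rw [Finset.card_eq_zero, Finset.union_eq_empty] at this
    exact this.1

/-- Only available players are matched, whatever the preference lists are. -/
theorem galeShapley_mem_players {P : Finset (Fin N)} {L : Fin N → List (Fin K)}
    {rank : Fin K → Fin N → ℕ} {capacity : Fin K → ℕ} {i : Fin N}
    (hi : galeShapley P L rank capacity i ≠ none) : i ∈ P := by
  have key : ∀ n, ∀ s : GSState N K, (s.free ⊆ P ∧ ∀ i, s.assigned i ≠ none → i ∈ P) →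
      (((gsStep rank capacity)^[n] s).free ⊆ P ∧
        ∀ i, ((gsStep rank capacity)^[n] s).assigned i ≠ none → i ∈ P) := by
    intro n
    induction n with
    | zero => exact fun s h => h
    | succ n ih =>
      rintro s ⟨h1, h2⟩
      rw [Function.iterate_succ_apply]
      apply ih
      by_cases hfree : s.free.Nonempty
      · have hpP := h1 (s.free.min'_mem hfree)
        have herase := (Finset.erase_subset (s.free.min' hfree) s.free).trans h1
        simp only [gsStep, dif_pos hfree]
        split
        · exact ⟨herase, h2⟩
        · split_ifs with hcard hw
          · refine ⟨herase, fun i hi => ?_⟩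
            by_cases hip : i = s.free.min' hfree
            · exact hip ▸ hpP
            · exact h2 i (by simpa [hip] using hi)
          · have hq := mem_matchedTo.1 hw.choose_spec.1
            refine ⟨Finset.insert_subset (h2 _ (by simp [hq])) herase, fun i hi => ?_⟩
            by_cases hip : i = s.free.min' hfree
            · exact hip ▸ hpP
            · by_cases hiq : i = hw.choose
              · exact h2 i (by rw [hiq, hq]; simp)
              · exact h2 i (by simpa [hip, hiq] using hi)
          · exact ⟨h1, h2⟩
      · simp only [gsStep, dif_neg hfree]
        exact ⟨h1, h2⟩
  exact (key _ _ ⟨subset_rfl, by simp⟩).2 i hi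

/-! ### Uniform random matchings -/

open Classical in
theorem card_filter_maxMatchings_le {P : Finset (Fin N)} {A : Finset (Fin K)} {i i' : Fin N}
    {j j' : Fin K} (hi : i ∈ P) (hi' : i' ∈ P) (hj : j ∈ A) (hj' : j' ∈ A) :
    ((maxMatchings P A).filter fun m => m i' = some j').card ≤
      ((maxMatchings P A).filter fun m => m i = some j).card := by
  have hP : ∀ p, Equiv.swap i i' p ∈ P → p ∈ P := by
    intro p hp
    by_cases h1 : p = i
    · exact h1 ▸ hi
    by_cases h2 : p = i'
    · exact h2 ▸ hi'
    rwa [Equiv.swap_apply_of_ne_of_ne h1 h2] at hp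
  have hA : ∀ a ∈ A, Equiv.swap j j' a ∈ A := by
    intro a ha
    by_cases h1 : a = j
    · rwa [h1, Equiv.swap_apply_left]
    by_cases h2 : a = j'
    · rwa [h2, Equiv.swap_apply_right]
    rwa [Equiv.swap_apply_of_ne_of_ne h1 h2]
  refine Finset.card_le_card_of_injOn
    (fun m p => (m (Equiv.swap i i' p)).map (Equiv.swap j j')) ?_ ?_
  · intro m hm
    simp only [Finset.coe_filter, maxMatchings, Finset.mem_filter, Finset.mem_univ, true_and,
      Set.mem_ofPred_eq, Option.map_eq_some_iff, Equiv.swap_apply_left] at hm ⊢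
    obtain ⟨⟨h1, h2, h3⟩, h4⟩ := hm
    refine ⟨⟨?_, ?_, ?_⟩, j', h4, Equiv.swap_apply_right _ _⟩
    · rintro p b ⟨a, hpa, rfl⟩
      exact ⟨hP p (h1 _ _ hpa).1, hA a (h1 _ _ hpa).2⟩
    · rintro p p' b ⟨a, hpa, rfl⟩ ⟨a', hpa', haa'⟩
      have := (Equiv.swap j j').injective haa'
      subst this
      exact (Equiv.swap i i').injective (h2 _ _ _ hpa hpa')
    · rw [← h3]
      refine Finset.card_equiv (Equiv.swap i i') fun p => ?_
      simp
  · intro m _ m' _ hmm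
    funext p
    have := congrFun hmm (Equiv.swap i i' p)
    simp only [Equiv.swap_apply_self] at this
    exact Option.map_injective (Equiv.swap j j').injective this

open Classical in
/-- A uniformly random maximum matching uses a given pair with probability at least `1 / K`. -/
theorem card_maxMatchings_le (hNK : N ≤ K) {P : Finset (Fin N)} {A : Finset (Fin K)} {i : Fin N}
    {j : Fin K} (hi : i ∈ P) (hj : j ∈ A) :
    (maxMatchings P A).card ≤ K * ((maxMatchings P A).filter fun m => m i = some j).card := by
  set S := maxMatchings P A with hS
  set c := (S.filter fun m => m i = some j).card with hc
  have hinner : ∀ m ∈ S, ∑ p ∈ P, ∑ a ∈ A, (if m p = some a then 1 else 0) =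
      min P.card A.card := by
    intro m hm
    simp only [hS, maxMatchings, Finset.mem_filter, Finset.mem_univ, true_and] at hm
    obtain ⟨h1, -, h3⟩ := hm
    rw [← h3, Finset.card_filter, ← Finset.sum_subset (Finset.subset_univ P)]
    · refine Finset.sum_congr rfl fun p _ => ?_
      cases hp : m p with
      | none => simp
      | some a => simp [(h1 p a hp).2]
    · intro p _ hp
      cases hpa : m p with
      | none => simp
      | some a => exact absurd (h1 p a hpa).1 hp
  have hcount : S.card * min P.card A.card ≤ P.card * (A.card * c) := by
    calc S.card * min P.card A.card
        = ∑ m ∈ S, ∑ p ∈ P, ∑ a ∈ A, (if m p = some a then 1 else 0) := by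
          rw [Finset.sum_congr rfl hinner, Finset.sum_const, smul_eq_mul]
      _ = ∑ p ∈ P, ∑ a ∈ A, (S.filter fun m => m p = some a).card := by
          rw [Finset.sum_comm]
          refine Finset.sum_congr rfl fun p _ => ?_
          rw [Finset.sum_comm]
          simp only [Finset.card_filter]
      _ ≤ ∑ p ∈ P, ∑ a ∈ A, c := Finset.sum_le_sum fun p hp => Finset.sum_le_sum fun a ha =>
          card_filter_maxMatchings_le hi hp hj ha
      _ = P.card * (A.card * c) := by simp
  have hPpos : 0 < P.card := Finset.card_pos.2 ⟨i, hi⟩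
  have hApos : 0 < A.card := Finset.card_pos.2 ⟨j, hj⟩
  have hPK : P.card ≤ K := (by simpa using P.card_le_univ : P.card ≤ N).trans hNK
  have hAK : A.card ≤ K := by simpa using A.card_le_univ
  rcases le_total P.card A.card with hle | hle
  · rw [min_eq_left hle, mul_comm] at hcount
    exact (Nat.le_of_mul_le_mul_left hcount hPpos).trans (Nat.mul_le_mul_right c hAK)
  · rw [min_eq_right hle, mul_comm, mul_left_comm] at hcount
    exact (Nat.le_of_mul_le_mul_left hcount hApos).trans (Nat.mul_le_mul_right c hPK)

/-! ### Counting matches and rewards -/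

open Classical in
/-- The number of rewards equal to 1 that player `i` has received from arm `j` in the past `h`. -/
def successCount {t : ℕ} (h : Fin t → Obs N K) (i : Fin N) (j : Fin K) : ℕ :=
  (Finset.univ.filter fun s => h s i = some (j, true)).card

open Classical in
theorem matchCount_snoc {t : ℕ} (h : Fin t → Obs N K) (o : Obs N K) (i : Fin N) (j : Fin K) :
    matchCount (Fin.snoc (α := fun _ => Obs N K) h o : Fin (t + 1) → Obs N K) i j =
      matchCount h i j + if ∃ b, o i = some (j, b) then 1 else 0 := by
  simp only [matchCount, Finset.card_filter, Fin.sum_univ_castSucc, Fin.snoc_castSucc,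
    Fin.snoc_last]

open Classical in
theorem successCount_snoc {t : ℕ} (h : Fin t → Obs N K) (o : Obs N K) (i : Fin N) (j : Fin K) :
    successCount (Fin.snoc (α := fun _ => Obs N K) h o : Fin (t + 1) → Obs N K) i j =
      successCount h i j + if o i = some (j, true) then 1 else 0 := by
  simp only [successCount, Finset.card_filter, Fin.sum_univ_castSucc, Fin.snoc_castSucc,
    Fin.snoc_last]

/-! ### Exploration -/

/-- In round `t` the algorithm explores although the pair `(i, j)`, which is available, has been
matched less than `L` times. -/
def Undersampled (E : Environment N K) (L : ℕ) {t : ℕ} (h : Fin t → Obs N K) (i : Fin N)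
    (j : Fin K) : Prop :=
  ¬ E.Separated h ∧ i ∈ E.players t ∧ j ∈ E.arms t ∧ matchCount h i j < L

namespace Market

variable (M : Market N K)

open Classical in
theorem finExp_roundLaw_min_matchCount (m : Matching N K) {t : ℕ} (h : Fin t → Obs N K)
    (i : Fin N) (j : Fin K) (L : ℕ) :
    finExp (M.roundLaw m) (fun o => ((min (matchCount
      (Fin.snoc (α := fun _ => Obs N K) h o : Fin (t + 1) → Obs N K) i j) L : ℕ) : ℝ)) =
      (min (matchCount h i j + if m i = some j then 1 else 0) L : ℕ) := by
  simp only [matchCount_snoc]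
  rw [M.finExp_roundLaw_eval m i
    (fun x => ((min (matchCount h i j + if ∃ b, x = some (j, b) then 1 else 0) L : ℕ) : ℝ))]
  cases hm : m i with
  | none => simp [finExp_playerLaw_none]
  | some a =>
    rw [finExp_playerLaw_some]
    by_cases ha : a = j
    · subst ha
      simp
      ring
    · simp [ha]
      ring

open Classical in
theorem undersampled_step (hNK : N ≤ K) {t : ℕ} (h : Fin t → Obs N K) (i : Fin N) (j : Fin K)
    (L : ℕ) :
    (if Undersampled M.toEnvironment L h i j then (1 : ℝ) else 0) ≤
      K * (finExp (acETGS M.toEnvironment t h) (fun m => finExp (M.roundLaw m) fun o =>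
        ((min (matchCount (Fin.snoc (α := fun _ => Obs N K) h o : Fin (t + 1) → Obs N K) i j) L
          : ℕ) : ℝ)) - (min (matchCount h i j) L : ℕ)) := by
  simp only [finExp_roundLaw_min_matchCount]
  have hK : (0 : ℝ) < K := Nat.cast_pos.2 (Fin.pos j)
  split_ifs with hu
  · obtain ⟨hsep, hi, hj, hlt⟩ := hu
    have hcard : (0 : ℝ) < (maxMatchings (M.players t) (M.arms t)).card :=
      Nat.cast_pos.2 (Finset.card_pos.2 (maxMatchings_nonempty _ _))
    have hle : ((maxMatchings (M.players t) (M.arms t)).card : ℝ) ≤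
        K * ((maxMatchings (M.players t) (M.arms t)).filter fun m => m i = some j).card :=
      mod_cast card_maxMatchings_le hNK hi hj
    have heq : ∀ m : Matching N K, ((min (matchCount h i j + if m i = some j then 1 else 0) L : ℕ)
        : ℝ) = matchCount h i j + if m i = some j then 1 else 0 := by
      intro m
      rw [min_eq_left]
      · push_cast
        rfl
      · split_ifs <;> omega
    simp only [heq]
    rw [finExp_add, finExp_const, min_eq_left hlt.le, add_sub_cancel_left, acETGS, if_neg hsep,
      finExp_uniformOfFinset, Finset.sum_boole, ← mul_div_assoc, le_div_iff₀ hcard, one_mul]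
    exact hle
  · refine mul_nonneg hK.le (sub_nonneg.2 ?_)
    rw [← finExp_const (acETGS M.toEnvironment t h) ((min (matchCount h i j) L : ℕ) : ℝ)]
    refine finExp_mono fun m => ?_
    exact mod_cast min_le_min_right L (Nat.le_add_right _ _)

open Classical in
/-- The expected number of rounds of exploration in which a given pair is available and
undersampled is at most `K * L`. -/
theorem sum_undersampled_le (hNK : N ≤ K) (i : Fin N) (j : Fin K) (L T : ℕ) :
    ∑ t ∈ Finset.range T, finExp (M.law (acETGS M.toEnvironment) t)
      (fun h => if Undersampled M.toEnvironment L h i j then (1 : ℝ) else 0) ≤ K * L := by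
  set π := acETGS M.toEnvironment with hπ
  have key : ∑ t ∈ Finset.range T, finExp (M.law π t)
      (fun h => if Undersampled M.toEnvironment L h i j then (1 : ℝ) else 0) ≤
      K * finExp (M.law π T) fun h => ((min (matchCount h i j) L : ℕ) : ℝ) := by
    induction T with
    | zero =>
      rw [Finset.sum_range_zero]
      exact mul_nonneg (Nat.cast_nonneg _) (finExp_nonneg fun _ => Nat.cast_nonneg _)
    | succ T ih =>
      rw [Finset.sum_range_succ, finExp_law_succ]
      have hstep := finExp_mono (p := M.law π T) fun h => M.undersampled_step hNK h i j L
      rw [finExp_const_mul, finExp_sub] at hstep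
      linarith
  refine key.trans (mul_le_mul_of_nonneg_left (finExp_le fun h => ?_) (Nat.cast_nonneg _))
  exact mod_cast min_le_right _ _

end Market

/-! ### Numbers of rounds -/

namespace Environment

variable (E : Environment N K)

theorem numRounds_succ (T : ℕ) (i : Fin N) :
    E.numRounds (T + 1) i = E.numRounds T i + if i ∈ E.players T then 1 else 0 := by
  simp only [numRounds, Finset.card_filter, Finset.sum_range_succ]

theorem numRounds_mono (i : Fin N) : Monotone fun T => E.numRounds T i :=
  monotone_nat_of_le_succ fun T => by
    rw [numRounds_succ]
    exact Nat.le_add_right _ _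

theorem sum_inv_localIndex (T : ℕ) (i : Fin N) :
    ∑ t ∈ Finset.range T, (if i ∈ E.players t then ((E.localIndex t i : ℝ))⁻¹ else 0) =
      (harmonic (E.numRounds T i) : ℝ) := by
  induction T with
  | zero => simp [numRounds]
  | succ T ih =>
    rw [Finset.sum_range_succ, ih, localIndex, numRounds_succ]
    split_ifs with hi
    · rw [harmonic_succ]
      push_cast
      rfl
    · simp

end Environment

/-! ### Concentration -/

/-- Hoeffding's lemma for a Bernoulli variable. -/
theorem bernoulli_mgf_le {p : ℝ} (h0 : 0 ≤ p) (h1 : p ≤ 1) (l : ℝ) :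
    p * Real.exp (l * (1 - p)) + (1 - p) * Real.exp (-(l * p)) ≤ Real.exp (l ^ 2 / 8) := by
  have hint : ∀ f : Bool → ℝ, ∫ b, f b ∂(bernoulliPMF p h0 h1).toMeasure =
      p * f true + (1 - p) * f false := by
    intro f
    rw [PMF.integral_eq_sum]
    exact finExp_bernoulliPMF p h0 h1 f
  have h := (ProbabilityTheory.hasSubgaussianMGF_of_mem_Icc (a := 0) (b := 1)
    (μ := (bernoulliPMF p h0 h1).toMeasure) (X := fun b : Bool => if b then (1 : ℝ) else 0)
    (measurable_of_finite _).aemeasurable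
    (Filter.Eventually.of_forall fun b => by cases b <;> simp)).mgf_le l
  rw [ProbabilityTheory.mgf, hint, hint] at h
  simp only [if_true, Bool.false_eq_true, if_false] at h
  convert h using 1
  · congr 2 <;> (congr 1; ring)
  · congr 1
    simp
    ring

namespace Market

variable (M : Market N K)

/-- The exponential supermartingale of the rewards that player `i` receives from arm `j`. -/
def expSupermartingale (l : ℝ) {t : ℕ} (h : Fin t → Obs N K) (i : Fin N) (j : Fin K) : ℝ :=
  Real.exp (l * (successCount h i j - M.mean i j * matchCount h i j)
    - matchCount h i j * (l ^ 2 / 8))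

open Classical in
theorem expSupermartingale_snoc (l : ℝ) {t : ℕ} (h : Fin t → Obs N K) (o : Obs N K) (i : Fin N)
    (j : Fin K) :
    M.expSupermartingale l (Fin.snoc (α := fun _ => Obs N K) h o : Fin (t + 1) → Obs N K) i j =
      M.expSupermartingale l h i j *
        Real.exp (l * ((if o i = some (j, true) then 1 else 0) -
            M.mean i j * (if ∃ b, o i = some (j, b) then 1 else 0)) -
          (if ∃ b, o i = some (j, b) then 1 else 0) * (l ^ 2 / 8)) := by
  rw [expSupermartingale, expSupermartingale, matchCount_snoc, successCount_snoc, ← Real.exp_add]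
  congr 1
  push_cast
  ring

theorem finExp_expSupermartingale_snoc_le (l : ℝ) (m : Matching N K) {t : ℕ} (h : Fin t → Obs N K)
    (i : Fin N) (j : Fin K) :
    finExp (M.roundLaw m) (fun o => M.expSupermartingale l
      (Fin.snoc (α := fun _ => Obs N K) h o : Fin (t + 1) → Obs N K) i j) ≤
      M.expSupermartingale l h i j := by
  classical
  simp only [expSupermartingale_snoc]
  rw [finExp_const_mul, M.finExp_roundLaw_eval m i (fun x =>
    Real.exp (l * ((if x = some (j, true) then 1 else 0) -
            M.mean i j * (if ∃ b, x = some (j, b) then 1 else 0)) -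
          (if ∃ b, x = some (j, b) then 1 else 0) * (l ^ 2 / 8)))]
  refine mul_le_of_le_one_right (Real.exp_pos _).le ?_
  cases hm : m i with
  | none => simp [finExp_playerLaw_none]
  | some a =>
    rw [finExp_playerLaw_some]
    by_cases ha : a = j
    · subst ha
      have hb := bernoulli_mgf_le (M.mean_pos i a).le (M.mean_lt_one i a).le l
      simp only [Option.some.injEq, Prod.mk.injEq, true_and, if_true, Bool.false_eq_true,
        if_false, exists_eq', mul_one, one_mul, zero_sub, Real.exp_sub, mul_neg]
      rw [← mul_div_assoc, ← mul_div_assoc, ← add_div]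
      exact (div_le_one (Real.exp_pos _)).2 hb
    · simp [ha]

theorem finExp_expSupermartingale_le_one (π : Policy N K) (l : ℝ) (t : ℕ) (i : Fin N) (j : Fin K) :
    finExp (M.law π t) (fun h => M.expSupermartingale l h i j) ≤ 1 := by
  induction t with
  | zero => exact finExp_le fun h => by simp [expSupermartingale, matchCount, successCount]
  | succ t ih =>
    rw [finExp_law_succ]
    refine le_trans (finExp_mono fun h => ?_) ih
    exact finExp_le fun m => M.finExp_expSupermartingale_snoc_le l m h i j

/-- The empirical mean of the pair `(i, j)` is outside the confidence interval in round `t`. -/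
def Deviates {t : ℕ} (h : Fin t → Obs N K) (i : Fin N) (j : Fin K) : Prop :=
  matchCount h i j ≠ 0 ∧
    √(Real.log (M.localIndex t i) / matchCount h i j) < |empMean h i j - M.mean i j|

theorem sq_localIndex_le_expSupermartingale {l : ℝ} {t : ℕ} {h : Fin t → Obs N K} {i : Fin N} {j : Fin K}
    (hτ : 1 ≤ M.localIndex t i) (hn : matchCount h i j ≠ 0)
    (hl : l ^ 2 = 16 * (Real.log (M.localIndex t i) / matchCount h i j))
    (hdev : 4 * (Real.log (M.localIndex t i) / matchCount h i j) ≤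
      l * (empMean h i j - M.mean i j)) :
    (M.localIndex t i : ℝ) ^ 2 ≤ M.expSupermartingale l h i j := by
  have hn' : (0 : ℝ) < matchCount h i j := Nat.cast_pos.2 (Nat.pos_of_ne_zero hn)
  have hτ' : (0 : ℝ) < M.localIndex t i := Nat.cast_pos.2 hτ
  have hmean : (successCount h i j : ℝ) = empMean h i j * matchCount h i j := by
    rw [empMean, div_mul_cancel₀ _ hn'.ne', successCount]
  have hlog := div_mul_cancel₀ (Real.log (M.localIndex t i)) hn'.ne'
  set r := Real.log (M.localIndex t i) / matchCount h i j with hr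
  have h2 : (M.localIndex t i : ℝ) ^ 2 = Real.exp (2 * Real.log (M.localIndex t i)) := by
    rw [two_mul, Real.exp_add, Real.exp_log hτ', sq]
  rw [h2, expSupermartingale, hmean, hl]
  refine Real.exp_le_exp.2 ?_
  have := mul_le_mul_of_nonneg_right hdev hn'.le
  nlinarith

open Classical in
theorem deviates_le_sum {t : ℕ} {h : Fin t → Obs N K} {i : Fin N} {j : Fin K}
    (hτ : 1 ≤ M.localIndex t i) (hn : matchCount h i j ≤ M.localIndex t i) :
    (if M.Deviates h i j then (1 : ℝ) else 0) ≤
      ∑ k ∈ Finset.Icc 1 (M.localIndex t i), ((M.localIndex t i : ℝ) ^ 2)⁻¹ *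
        (M.expSupermartingale (4 * √(Real.log (M.localIndex t i) / k)) h i j +
          M.expSupermartingale (-(4 * √(Real.log (M.localIndex t i) / k))) h i j) := by
  have hτ' : (0 : ℝ) < M.localIndex t i := Nat.cast_pos.2 hτ
  have hpos : ∀ k ∈ Finset.Icc 1 (M.localIndex t i), 0 ≤ ((M.localIndex t i : ℝ) ^ 2)⁻¹ *
        (M.expSupermartingale (4 * √(Real.log (M.localIndex t i) / k)) h i j +
          M.expSupermartingale (-(4 * √(Real.log (M.localIndex t i) / k))) h i j) := fun k _ =>
    mul_nonneg (by positivity) (add_nonneg (Real.exp_pos _).le (Real.exp_pos _).le)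
  split_ifs with hd
  · obtain ⟨h0, hd⟩ := hd
    refine le_trans ?_ (Finset.single_le_sum hpos
      (Finset.mem_Icc.2 ⟨Nat.one_le_iff_ne_zero.2 h0, hn⟩))
    rw [← div_eq_inv_mul, le_div_iff₀ (by positivity), one_mul]
    have hr : 0 ≤ Real.log (M.localIndex t i) / matchCount h i j :=
      div_nonneg (Real.log_natCast_nonneg _) (Nat.cast_nonneg _)
    have hsq := Real.sq_sqrt hr
    have hnn := Real.sqrt_nonneg (Real.log (M.localIndex t i) / matchCount h i j)
    set s := √(Real.log (M.localIndex t i) / matchCount h i j) with hs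
    rcases lt_abs.1 hd with hd | hd
    · refine (M.sq_localIndex_le_expSupermartingale hτ h0 (l := 4 * s) ?_ ?_).trans
        (le_add_of_nonneg_right (Real.exp_pos _).le)
      · rw [← hsq]
        ring
      · rw [← hsq]
        nlinarith
    · refine (M.sq_localIndex_le_expSupermartingale hτ h0 (l := -(4 * s)) ?_ ?_).trans
        (le_add_of_nonneg_left (Real.exp_pos _).le)
      · rw [← hsq]
        ring
      · rw [← hsq]
        nlinarith
  · exact Finset.sum_nonneg hpos

/-- Almost surely nothing is observed from unavailable players. -/
theorem eq_none_of_law_acETGS {t : ℕ} {h : Fin t → Obs N K}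
    (hh : M.law (acETGS M.toEnvironment) t h ≠ 0) (s : Fin t) {i : Fin N}
    (hi : i ∉ M.players s) : h s i = none := by
  induction t with
  | zero => exact s.elim0
  | succ t ih =>
    rw [law, ← PMF.mem_support_iff, PMF.mem_support_bind_iff] at hh
    obtain ⟨h', hh', hh⟩ := hh
    rw [PMF.mem_support_bind_iff] at hh
    obtain ⟨m, hm, hh⟩ := hh
    rw [PMF.mem_support_map_iff] at hh
    obtain ⟨o, ho, rfl⟩ := hh
    induction s using Fin.lastCases with
    | cast s =>
      rw [Fin.snoc_castSucc]
      exact ih hh' s hi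
    | last =>
      rw [Fin.snoc_last]
      rw [Fin.val_last] at hi
      have hmi : m i = none := by
        by_contra hne
        rw [acETGS] at hm
        split_ifs at hm with hsep
        · rw [PMF.mem_support_pure_iff] at hm
          subst hm
          exact hi (galeShapley_mem_players hne)
        · rw [PMF.mem_support_uniformOfFinset_iff, maxMatchings, Finset.mem_filter] at hm
          obtain ⟨a, ha⟩ := Option.ne_none_iff_exists'.1 hne
          exact hi (hm.2.1 i a ha).1
      rw [PMF.mem_support_iff, roundLaw, piPMF, PMF.ofFintype_apply] at ho
      have := Finset.prod_ne_zero_iff.1 ho i (Finset.mem_univ i)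
      rw [hmi, playerLaw, ← PMF.mem_support_iff, PMF.mem_support_pure_iff] at this
      exact this

theorem matchCount_le_localIndex {t : ℕ} {h : Fin t → Obs N K}
    (hh : M.law (acETGS M.toEnvironment) t h ≠ 0) (i : Fin N) (j : Fin K) :
    matchCount h i j ≤ M.localIndex t i := by
  refine le_trans ?_ (M.numRounds_mono i (Nat.le_succ t))
  change matchCount h i j ≤ M.numRounds t i
  rw [matchCount, Environment.numRounds]
  refine Finset.card_le_card_of_injOn (fun s => (s : ℕ)) ?_ Fin.val_injective.injOn
  intro s hs
  simp only [Finset.coe_filter, Finset.mem_univ, true_and, Set.mem_ofPred_eq] at hs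
  simp only [Finset.coe_filter, Finset.mem_range, Set.mem_ofPred_eq]
  refine ⟨s.2, ?_⟩
  by_contra hi
  obtain ⟨b, hb⟩ := hs
  rw [M.eq_none_of_law_acETGS hh s hi] at hb
  cases hb

open Classical in
/-- The probability that a confidence interval fails in the `τ`-th round of a player is at most
`2 / τ`. -/
theorem finExp_deviates_le {t : ℕ} {i : Fin N} (hi : i ∈ M.players t) (j : Fin K) :
    finExp (M.law (acETGS M.toEnvironment) t) (fun h => if M.Deviates h i j then (1 : ℝ) else 0) ≤
      2 * (M.localIndex t i : ℝ)⁻¹ := by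
  have hτ : 1 ≤ M.localIndex t i := by
    rw [Environment.localIndex, Environment.numRounds_succ, if_pos hi]
    exact Nat.le_add_left _ _
  have hτ' : (0 : ℝ) < M.localIndex t i := Nat.cast_pos.2 hτ
  refine (finExp_mono_support fun h hh =>
    M.deviates_le_sum hτ (M.matchCount_le_localIndex hh i j)).trans ?_
  rw [finExp_sum]
  calc _ ≤ ∑ k ∈ Finset.Icc 1 (M.localIndex t i), ((M.localIndex t i : ℝ) ^ 2)⁻¹ * 2 := by
        refine Finset.sum_le_sum fun k _ => ?_
        rw [finExp_const_mul, finExp_add]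
        refine mul_le_mul_of_nonneg_left ?_ (by positivity)
        exact (add_le_add (M.finExp_expSupermartingale_le_one _ _ t i j)
          (M.finExp_expSupermartingale_le_one _ _ t i j)).trans_eq one_add_one_eq_two
    _ = 2 * (M.localIndex t i : ℝ)⁻¹ := by
        rw [Finset.sum_const, Nat.card_Icc, Nat.add_sub_cancel, nsmul_eq_mul]
        field_simp

open Classical in
/-- The expected number of failures of the confidence intervals of a pair. -/
theorem sum_deviates_le (i : Fin N) (j : Fin K) (T : ℕ) :
    ∑ t ∈ Finset.range T, finExp (M.law (acETGS M.toEnvironment) t)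
      (fun h => if i ∈ M.players t ∧ M.Deviates h i j then (1 : ℝ) else 0) ≤
      2 * (1 + Real.log (M.numRounds T i)) := by
  have hh : (harmonic (M.numRounds T i) : ℝ) ≤ 1 + Real.log (M.numRounds T i) :=
    harmonic_le_one_add_log _
  refine le_trans ?_ (mul_le_mul_of_nonneg_left hh zero_le_two)
  rw [← M.sum_inv_localIndex, Finset.mul_sum]
  refine Finset.sum_le_sum fun t _ => ?_
  by_cases hi : i ∈ M.players t
  · simp only [hi, true_and, if_true]
    exact M.finExp_deviates_le hi j
  · simp only [hi, false_and, if_false, mul_zero]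
    exact (finExp_const _ _).le

end Market

/-! ### Confidence bounds and separation -/

theorem Environment.lcb_le_ucb (E : Environment N K) {t : ℕ} (h : Fin t → Obs N K) (i : Fin N)
    (j : Fin K) : E.lcb h i j ≤ E.ucb h i j := by
  unfold Environment.lcb Environment.ucb
  split_ifs
  · exact bot_le
  · rw [EReal.coe_le_coe_iff]
    linarith [Real.sqrt_nonneg (Real.log (E.localIndex t i) / matchCount h i j)]

namespace Market

variable (M : Market N K)

theorem lcb_le_mean {t : ℕ} {h : Fin t → Obs N K} {i : Fin N} {j : Fin K}
    (hd : ¬ M.Deviates h i j) : M.lcb h i j ≤ (M.mean i j : EReal) := by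
  unfold Environment.lcb
  split_ifs with h0
  · exact bot_le
  · rw [EReal.coe_le_coe_iff]
    have := le_of_abs_le (not_lt.1 fun hlt => hd ⟨h0, hlt⟩)
    linarith

theorem mean_le_ucb {t : ℕ} {h : Fin t → Obs N K} {i : Fin N} {j : Fin K}
    (hd : ¬ M.Deviates h i j) : (M.mean i j : EReal) ≤ M.ucb h i j := by
  unfold Environment.ucb
  split_ifs with h0
  · exact le_top
  · rw [EReal.coe_le_coe_iff]
    have := neg_le_of_abs_le (not_lt.1 fun hlt => hd ⟨h0, hlt⟩)
    linarith

/-- If the confidence intervals are valid and separated, then the upper confidence bounds order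
the arms as the mean rewards do. -/
theorem mean_lt_of_ucb_le {t : ℕ} {h : Fin t → Obs N K} (hsep : M.Separated h) {i : Fin N}
    (hi : i ∈ M.players t) (hd : ∀ j ∈ M.arms t, ¬ M.Deviates h i j) {a b : Fin K}
    (ha : a ∈ M.arms t) (hb : b ∈ M.arms t) (hab : a ≠ b) (hle : M.ucb h i b ≤ M.ucb h i a) :
    M.mean i b < M.mean i a := by
  obtain ⟨σ, hσ⟩ := hsep i hi
  have hchain : ∀ (d k : ℕ) (hk : k + 1 + d < (M.arms t).card),
      M.ucb h i (σ ⟨k + 1 + d, hk⟩) < M.lcb h i (σ ⟨k, by omega⟩) := by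
    intro d
    induction d with
    | zero => exact fun k hk => hσ k hk
    | succ d ih =>
      intro k hk
      exact ((hσ (k + 1 + d) hk).trans_le (M.lcb_le_ucb _ _ _)).trans (ih k (by omega))
  have hlt : ∀ k l : Fin (M.arms t).card, k < l → M.ucb h i (σ l) < M.lcb h i (σ k) := by
    rintro ⟨k, hk⟩ ⟨l, hl⟩ hkl
    have hkl' : k < l := hkl
    obtain ⟨d, rfl⟩ := Nat.exists_eq_add_of_le (Nat.succ_le_of_lt hkl')
    exact hchain d k hl
  obtain ⟨k, hk⟩ := σ.surjective ⟨a, ha⟩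
  obtain ⟨l, hl⟩ := σ.surjective ⟨b, hb⟩
  rcases lt_trichotomy k l with hkl | rfl | hkl
  · have h1 := hlt k l hkl
    rw [hk, hl] at h1
    have h2 := (M.mean_le_ucb (hd b hb)).trans_lt (h1.trans_le (M.lcb_le_mean (hd a ha)))
    exact EReal.coe_lt_coe_iff.1 h2
  · exact absurd (Subtype.ext_iff.1 (hk.symm.trans hl)) hab
  · have h1 := hlt l k hkl
    rw [hk, hl] at h1
    exact absurd hle (not_le.2 (h1.trans_le (M.lcb_le_ucb _ _ _)))

theorem isPrefList_insertionSort {t : ℕ} (r : Fin N → Fin K → Fin K → Prop)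
    [∀ i, DecidableRel (r i)] [∀ i, Std.Total (r i)] [∀ i, IsTrans (Fin K) (r i)]
    (hr : ∀ i ∈ M.players t, ∀ a ∈ M.arms t, ∀ b ∈ M.arms t, a ≠ b → r i a b →
      M.mean i b < M.mean i a) :
    IsPrefList M t fun i => ((M.arms t).sort (· ≤ ·)).insertionSort (r i) := by
  intro i hi
  have hmem : ∀ a, a ∈ ((M.arms t).sort (· ≤ ·)).insertionSort (r i) ↔ a ∈ M.arms t := by
    intro a
    rw [(List.perm_insertionSort (r i) _).mem_iff, Finset.mem_sort]
  refine ⟨hmem, ?_⟩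
  have hnd : (((M.arms t).sort (· ≤ ·)).insertionSort (r i)).Nodup :=
    (List.perm_insertionSort (r i) _).nodup_iff.2 (Finset.sort_nodup _ _)
  refine (List.Pairwise.and hnd (List.pairwise_insertionSort (r i) _)).imp_of_mem ?_
  intro a b ha hb hab
  exact hr i hi a ((hmem a).1 ha) b ((hmem b).1 hb) hab.1 hab.2

theorem length_insertionSort_sort_le {A : Finset (Fin K)} (r : Fin K → Fin K → Prop)
    [DecidableRel r] : ((A.sort (· ≤ ·)).insertionSort r).length ≤ K := by
  rw [List.length_insertionSort, Finset.length_sort]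
  simpa using A.card_le_univ

theorem galeShapley_ucbList_isPlayerOptimal {t : ℕ} {h : Fin t → Obs N K} (hsep : M.Separated h)
    (hd : ∀ i ∈ M.players t, ∀ j ∈ M.arms t, ¬ M.Deviates h i j) :
    M.IsPlayerOptimal t
      (galeShapley (M.players t) (M.ucbList h) (M.rank t) (M.capacity t)) := by
  classical
  refine galeShapley_isPlayerOptimal ?_ fun i => length_insertionSort_sort_le _
  have : ∀ i, Std.Total fun j j' => M.ucb h i j' ≤ M.ucb h i j := fun i =>
    ⟨fun a b => le_total _ _⟩
  have : ∀ i, IsTrans (Fin K) fun j j' => M.ucb h i j' ≤ M.ucb h i j := fun i =>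
    ⟨fun a b c hab hbc => hbc.trans hab⟩
  exact M.isPrefList_insertionSort (fun i j j' => M.ucb h i j' ≤ M.ucb h i j)
    fun i hi a ha b hb hab hle => M.mean_lt_of_ucb_le hsep hi (hd i hi) ha hb hab hle

theorem existsUnique_isPlayerOptimal (t : ℕ) : ∃! m, M.IsPlayerOptimal t m := by
  classical
  have : ∀ i, Std.Total fun j j' => M.mean i j' ≤ M.mean i j := fun i =>
    ⟨fun a b => le_total _ _⟩
  have : ∀ i, IsTrans (Fin K) fun j j' => M.mean i j' ≤ M.mean i j := fun i =>
    ⟨fun a b c hab hbc => hbc.trans hab⟩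
  have hL := M.isPrefList_insertionSort (t := t) (fun i j j' => M.mean i j' ≤ M.mean i j)
    fun i hi a ha b hb hab hle => lt_of_le_of_ne hle (M.mean_ne t i hi b hb a ha hab.symm)
  have h := galeShapley_isPlayerOptimal hL fun i => length_insertionSort_sort_le _
  exact ⟨_, h, fun m hm => M.eq_of_isPlayerOptimal hm h⟩

/-- Valid confidence intervals are separated once all pairs have been sampled often enough. -/
theorem separated_of_le_matchCount {t : ℕ} {h : Fin t → Obs N K} {Δ : ℝ} {L : ℕ} (hΔ : 0 < Δ)
    (hgap : ∀ i ∈ M.players t, ∀ a ∈ M.arms t, ∀ b ∈ M.arms t, a ≠ b →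
      Δ ≤ |M.mean i a - M.mean i b|)
    (hL : ∀ i ∈ M.players t, 16 * Real.log (M.localIndex t i) < L * Δ ^ 2)
    (hd : ∀ i ∈ M.players t, ∀ j ∈ M.arms t, ¬ M.Deviates h i j)
    (hn : ∀ i ∈ M.players t, ∀ j ∈ M.arms t, L ≤ matchCount h i j) : M.Separated h := by
  intro i hi
  let e : Fin (M.arms t).card ≃ M.arms t := (M.arms t).equivFin.symm
  let f : Fin (M.arms t).card → ℝ := fun k => -M.mean i (e k)
  refine ⟨(Tuple.sort f).trans e, fun k hk => ?_⟩
  have hmono := Tuple.monotone_sort f (Fin.mk_le_mk.2 k.le_succ :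
    (⟨k, Nat.lt_of_succ_lt hk⟩ : Fin (M.arms t).card) ≤ ⟨k + 1, hk⟩)
  have hne : ((Tuple.sort f).trans e ⟨k, Nat.lt_of_succ_lt hk⟩ : Fin K) ≠
      (Tuple.sort f).trans e ⟨k + 1, hk⟩ := by
    intro heq
    have := ((Tuple.sort f).trans e).injective (Subtype.ext heq)
    simp at this
  have hle : M.mean i ((Tuple.sort f).trans e ⟨k + 1, hk⟩) ≤
      M.mean i ((Tuple.sort f).trans e ⟨k, Nat.lt_of_succ_lt hk⟩) := neg_le_neg_iff.1 hmono
  generalize hA : (Tuple.sort f).trans e ⟨k, Nat.lt_of_succ_lt hk⟩ = a at hne hle ⊢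
  generalize hB : (Tuple.sort f).trans e ⟨k + 1, hk⟩ = b at hne hle ⊢
  have hg := hgap i hi a a.2 b b.2 hne
  rw [abs_of_nonneg (sub_nonneg.2 hle)] at hg
  have hlog := Real.log_natCast_nonneg (M.localIndex t i)
  have hLpos : 0 < L := by
    rcases Nat.eq_zero_or_pos L with h0 | h0
    · have := hL i hi
      rw [h0, Nat.cast_zero, zero_mul] at this
      linarith
    · exact h0
  have hrad : ∀ j ∈ M.arms t, √(Real.log (M.localIndex t i) / matchCount h i j) < Δ / 4 := by
    intro j hj
    have hLn : (L : ℝ) ≤ matchCount h i j := Nat.cast_le.2 (hn i hi j hj)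
    have hn0 : (0 : ℝ) < matchCount h i j := (Nat.cast_pos.2 hLpos).trans_le hLn
    rw [Real.sqrt_lt' (by positivity), div_lt_iff₀ hn0]
    have := hL i hi
    nlinarith [mul_le_mul_of_nonneg_right hLn (sq_nonneg Δ)]
  have ha0 : matchCount h i (a : Fin K) ≠ 0 := (hLpos.trans_le (hn i hi a a.2)).ne'
  have hb0 : matchCount h i (b : Fin K) ≠ 0 := (hLpos.trans_le (hn i hi b b.2)).ne'
  have hda := abs_le.1 (not_lt.1 fun hlt => hd i hi a a.2 ⟨ha0, hlt⟩)
  have hdb := abs_le.1 (not_lt.1 fun hlt => hd i hi b b.2 ⟨hb0, hlt⟩)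
  have hra := hrad a a.2
  have hrb := hrad b b.2
  rw [Environment.ucb, Environment.lcb, if_neg ha0, if_neg hb0, EReal.coe_lt_coe_iff]
  linarith [hda.1, hdb.2]

end Market

/-! ### The regret bound -/

namespace Market

variable (M : Market N K)

open Classical in
/-- In a single round, the loss of a player is at most the probability that a confidence interval
fails or that the algorithm explores while some pair is undersampled. -/
theorem abs_value_sub_finExp_le {t : ℕ} (h : Fin t → Obs N K) {m : Matching N K}
    (hm : M.IsPlayerOptimal t m) {L : ℕ} {Δ : ℝ} (hΔ : 0 < Δ)
    (hgap : ∀ i ∈ M.players t, ∀ a ∈ M.arms t, ∀ b ∈ M.arms t, a ≠ b →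
      Δ ≤ |M.mean i a - M.mean i b|)
    (hL : ∀ i ∈ M.players t, 16 * Real.log (M.localIndex t i) < L * Δ ^ 2) (i : Fin N) :
    |M.value i (m i) - finExp (acETGS M.toEnvironment t h) fun m' => M.value i (m' i)| ≤
      ∑ p : Fin N, ∑ j : Fin K, ((if p ∈ M.players t ∧ M.Deviates h p j then (1 : ℝ) else 0) +
        if Undersampled M.toEnvironment L h p j then (1 : ℝ) else 0) := by
  have hterm : ∀ (p : Fin N) (j : Fin K),
      0 ≤ (if p ∈ M.players t ∧ M.Deviates h p j then (1 : ℝ) else 0) +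
        if Undersampled M.toEnvironment L h p j then (1 : ℝ) else 0 := fun p j => by
    positivity
  have hnonneg : 0 ≤ ∑ p : Fin N, ∑ j : Fin K,
      ((if p ∈ M.players t ∧ M.Deviates h p j then (1 : ℝ) else 0) +
        if Undersampled M.toEnvironment L h p j then (1 : ℝ) else 0) :=
    Finset.sum_nonneg fun p _ => Finset.sum_nonneg fun j _ => hterm p j
  have hone : |M.value i (m i) - finExp (acETGS M.toEnvironment t h) fun m' => M.value i (m' i)|
      ≤ 1 := by
    have h1 := M.value_nonneg i (m i)
    have h2 := M.value_le_one i (m i)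
    have h3 : 0 ≤ finExp (acETGS M.toEnvironment t h) fun m' => M.value i (m' i) :=
      finExp_nonneg fun m' => M.value_nonneg i _
    have h4 : (finExp (acETGS M.toEnvironment t h) fun m' => M.value i (m' i)) ≤ 1 :=
      finExp_le fun m' => M.value_le_one i _
    rw [abs_le]
    constructor <;> linarith
  have hsingle : ∀ (p : Fin N) (j : Fin K),
      (p ∈ M.players t ∧ M.Deviates h p j) ∨ Undersampled M.toEnvironment L h p j →
      1 ≤ ∑ p : Fin N, ∑ j : Fin K,
        ((if p ∈ M.players t ∧ M.Deviates h p j then (1 : ℝ) else 0) +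
          if Undersampled M.toEnvironment L h p j then (1 : ℝ) else 0) := by
    intro p j hpj
    refine le_trans ?_ ((Finset.single_le_sum (fun j _ => hterm p j) (Finset.mem_univ j)).trans
      (Finset.single_le_sum (f := fun p => ∑ j : Fin K,
        ((if p ∈ M.players t ∧ M.Deviates h p j then (1 : ℝ) else 0) +
          if Undersampled M.toEnvironment L h p j then (1 : ℝ) else 0))
        (fun p _ => Finset.sum_nonneg fun j _ => hterm p j) (Finset.mem_univ p)))
    rcases hpj with hpj | hpj
    · rw [if_pos hpj]
      exact le_add_of_nonneg_right (by positivity)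
    · rw [if_pos hpj]
      exact le_add_of_nonneg_left (by positivity)
  by_cases hd : ∀ p ∈ M.players t, ∀ j ∈ M.arms t, ¬ M.Deviates h p j
  · by_cases hsep : M.Separated h
    · have heq := M.eq_of_isPlayerOptimal hm (M.galeShapley_ucbList_isPlayerOptimal hsep hd)
      rw [acETGS, if_pos hsep, finExp_pure, ← heq, sub_self, abs_zero]
      exact hnonneg
    · obtain ⟨p, hp, j, hj, hlt⟩ : ∃ p ∈ M.players t, ∃ j ∈ M.arms t, matchCount h p j < L := by
        by_contra! hn
        exact hsep (M.separated_of_le_matchCount hΔ hgap hL hd hn)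
      exact hone.trans (hsingle p j (Or.inr ⟨hsep, hp, hj, hlt⟩))
  · push Not at hd
    obtain ⟨p, hp, j, -, hdev⟩ := hd
    exact hone.trans (hsingle p j (Or.inl ⟨hp, hdev⟩))

theorem abs_regret_le (hNK : N ≤ K) {T : ℕ} {Δ : ℝ} (hΔ : 0 < Δ) {L : ℕ} {B : ℝ}
    (hgap : ∀ x ∈ M.gaps T, Δ ≤ x)
    (hB : ∀ p : Fin N, Real.log (M.numRounds T p) ≤ B) (hL : 16 * B < L * Δ ^ 2)
    {mbar : ℕ → Matching N K} (hm : ∀ t < T, M.IsPlayerOptimal t (mbar t)) (i : Fin N) :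
    |M.regret (acETGS M.toEnvironment) mbar T i| ≤ N * K * (2 * (1 + B) + K * L) := by
  classical
  set π := acETGS M.toEnvironment with hπ
  have hround : ∀ t : Fin T, |M.value i (mbar t i) - M.expect π T fun ω => reward (ω t i)| ≤
      ∑ p : Fin N, ∑ j : Fin K, (finExp (M.law π t)
        (fun h => if p ∈ M.players t ∧ M.Deviates h p j then (1 : ℝ) else 0) +
        finExp (M.law π t)
          (fun h => if Undersampled M.toEnvironment L h p j then (1 : ℝ) else 0)) := by
    intro t
    rw [expect_reward, ← finExp_const (M.law π t) (M.value i (mbar t i)), ← finExp_sub]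
    simp only [← finExp_add, ← finExp_sum]
    refine (abs_finExp_le _ _).trans (finExp_mono fun h => ?_)
    refine M.abs_value_sub_finExp_le h (hm t t.2) hΔ ?_ ?_ i
    · intro p hp a ha b hb hab
      exact hgap _ ⟨t, t.2, p, hp, a, ha, b, hb, hab, rfl⟩
    · intro p hp
      refine lt_of_le_of_lt (mul_le_mul_of_nonneg_left ((Real.log_le_log ?_ ?_).trans (hB p))
        (by norm_num)) hL
      · rw [Environment.localIndex, Environment.numRounds_succ, if_pos hp]
        positivity
      · exact Nat.cast_le.2 (M.numRounds_mono p (Nat.succ_le_of_lt t.2))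
  calc |M.regret π mbar T i|
      ≤ ∑ t ∈ Finset.univ.filter (fun t : Fin T => i ∈ M.players t),
          |M.value i (mbar t i) - M.expect π T fun ω => reward (ω t i)| :=
        Finset.abs_sum_le_sum_abs _ _
    _ ≤ ∑ t : Fin T, |M.value i (mbar t i) - M.expect π T fun ω => reward (ω t i)| :=
        Finset.sum_le_sum_of_subset_of_nonneg (Finset.filter_subset _ _)
          fun _ _ _ => abs_nonneg _
    _ ≤ ∑ t : Fin T, ∑ p : Fin N, ∑ j : Fin K, (finExp (M.law π t)
        (fun h => if p ∈ M.players t ∧ M.Deviates h p j then (1 : ℝ) else 0) +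
        finExp (M.law π t)
          (fun h => if Undersampled M.toEnvironment L h p j then (1 : ℝ) else 0)) :=
        Finset.sum_le_sum fun t _ => hround t
    _ = ∑ p : Fin N, ∑ j : Fin K, (∑ t ∈ Finset.range T, finExp (M.law π t)
        (fun h => if p ∈ M.players t ∧ M.Deviates h p j then (1 : ℝ) else 0) +
        ∑ t ∈ Finset.range T, finExp (M.law π t)
          (fun h => if Undersampled M.toEnvironment L h p j then (1 : ℝ) else 0)) := by
        simp only [← Finset.sum_add_distrib]
        rw [Fin.sum_univ_eq_sum_range (fun t => ∑ p : Fin N, ∑ j : Fin K, (finExp (M.law π t)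
          (fun h => if p ∈ M.players t ∧ M.Deviates h p j then (1 : ℝ) else 0) +
          finExp (M.law π t)
            (fun h => if Undersampled M.toEnvironment L h p j then (1 : ℝ) else 0))) T,
          Finset.sum_comm]
        exact Finset.sum_congr rfl fun p _ => Finset.sum_comm
    _ ≤ ∑ p : Fin N, ∑ j : Fin K, (2 * (1 + B) + K * L) := by
        refine Finset.sum_le_sum fun p _ => Finset.sum_le_sum fun j _ => ?_
        refine add_le_add ((M.sum_deviates_le p j T).trans ?_) (M.sum_undersampled_le hNK p j L T)
        linarith [hB p]
    _ = N * K * (2 * (1 + B) + K * L) := by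
        simp
        ring

end Market

end SleepingBandits

end

theorem theorem4 (κ : ℝ) :
    ∃ C : ℝ, ∀ (N K : ℕ), N ≤ K → ∀ (M : SleepingBandits.Market N K) (T : ℕ) (Δ : ℝ),
      IsLeast (M.gaps T) Δ →
      (∀ i i' : Fin N, (M.numRounds T i : ℝ) ≤ κ * M.numRounds T i') →
      (∀ t, ∃! m, M.IsPlayerOptimal t m) ∧
      ∀ mbar : ℕ → SleepingBandits.Matching N K, (∀ t < T, M.IsPlayerOptimal t (mbar t)) →
        ∀ i : Fin N, 2 ≤ M.numRounds T i →
          |M.regret (SleepingBandits.acETGS M.toEnvironment) mbar T i| ≤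
            C * (N * K ^ 2 * Real.log (M.numRounds T i) / Δ ^ 2) := by
  refine ⟨3 / Real.log 2 + 18 * (1 + Real.log κ / Real.log 2), ?_⟩
  intro N K hNK M T Δ hΔ hκ
  refine ⟨M.existsUnique_isPlayerOptimal, fun mbar hm i hi => ?_⟩
  have hlog2 : 0 < Real.log 2 := Real.log_pos one_lt_two
  have hTi : (2 : ℝ) ≤ M.numRounds T i := mod_cast hi
  have hκ1 : 1 ≤ κ := by
    have := hκ i i
    nlinarith
  have hlogκ : 0 ≤ Real.log κ := Real.log_nonneg hκ1
  have hℓ : Real.log 2 ≤ Real.log (M.numRounds T i) := Real.log_le_log two_pos hTi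
  obtain ⟨hΔ0, hΔ1⟩ : 0 < Δ ∧ Δ < 1 := by
    obtain ⟨t, -, p, hp, a, ha, b, hb, hab, rfl⟩ := hΔ.1
    refine ⟨abs_pos.2 (sub_ne_zero.2 (M.mean_ne t p hp a ha b hb hab)), abs_lt.2 ⟨?_, ?_⟩⟩ <;>
      linarith [M.mean_pos p a, M.mean_pos p b, M.mean_lt_one p a, M.mean_lt_one p b]
  set ℓ := Real.log (M.numRounds T i) with hℓdef
  set c := 1 + Real.log κ / Real.log 2 with hc
  have hc0 : 0 ≤ c := by positivity
  have hℓ0 : 0 < ℓ := hlog2.trans_le hℓ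
  have hB : ∀ p : Fin N, Real.log (M.numRounds T p) ≤ c * ℓ := by
    intro p
    rcases Nat.eq_zero_or_pos (M.numRounds T p) with h0 | h0
    · rw [h0, Nat.cast_zero, Real.log_zero]
      positivity
    · calc Real.log (M.numRounds T p) ≤ Real.log (κ * M.numRounds T i) :=
            Real.log_le_log (Nat.cast_pos.2 h0) (hκ p i)
        _ = Real.log κ / Real.log 2 * Real.log 2 + ℓ := by
            rw [Real.log_mul (by positivity) (by positivity), div_mul_cancel₀ _ hlog2.ne']
        _ ≤ Real.log κ / Real.log 2 * ℓ + ℓ := by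
            have := mul_le_mul_of_nonneg_left hℓ (div_nonneg hlogκ hlog2.le)
            linarith
        _ = c * ℓ := by rw [hc]; ring
  have hsq0 : 0 < Δ ^ 2 := by positivity
  have hsq1 : Δ ^ 2 ≤ 1 := pow_le_one₀ hΔ0.le hΔ1.le
  set L := ⌊16 * (c * ℓ) / Δ ^ 2⌋₊ + 1 with hLdef
  have hL : 16 * (c * ℓ) < L * Δ ^ 2 := by
    rw [← div_lt_iff₀ hsq0, hLdef]
    push_cast
    exact Nat.lt_floor_add_one _
  have hL' : (L : ℝ) ≤ 16 * (c * ℓ) / Δ ^ 2 + 1 := by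
    rw [hLdef]
    push_cast
    exact add_le_add_left (Nat.floor_le (by positivity)) 1
  have hK : (1 : ℝ) ≤ K := Nat.one_le_cast.2 ((Fin.pos i).trans_le hNK)
  have hone : 1 ≤ ℓ / Real.log 2 / Δ ^ 2 := by
    rw [le_div_iff₀ hsq0, one_mul]
    exact hsq1.trans ((one_le_div hlog2).2 hℓ)
  have hcℓ : c * ℓ ≤ c * ℓ / Δ ^ 2 := le_div_self (by positivity) hsq0 hsq1
  refine (M.abs_regret_le hNK hΔ0 hΔ.2 hB hL hm i).trans ?_
  calc (N : ℝ) * K * (2 * (1 + c * ℓ) + K * L)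
      ≤ N * K * (K * (2 * (ℓ / Real.log 2 / Δ ^ 2 + c * ℓ / Δ ^ 2)) +
          K * (16 * (c * ℓ) / Δ ^ 2 + ℓ / Real.log 2 / Δ ^ 2)) := by
        refine mul_le_mul_of_nonneg_left (add_le_add ?_ ?_) (by positivity)
        · refine le_trans ?_ (le_mul_of_one_le_left (by positivity) hK)
          linarith
        · exact mul_le_mul_of_nonneg_left (by linarith) (by positivity)
    _ = (3 / Real.log 2 + 18 * c) * (N * K ^ 2 * ℓ / Δ ^ 2) := by ring
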